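/- **Setting.** Let $d\ge 1$. Source $i=0$ is the expert (its law $P_0$ is also the target law) and sources $i=1,\dots,m$ are the workers; $P_i$ is a probability law of $(X,Y)\in\mathbb R^d\times\{0,1\}$ with marginal $P_i^X$ and regression function $\eta_i(x)=P_i(Y=1\mid X=x)\in[0,1]$. Source $i$ contributes $n_i$ i.i.d. observations from $P_i$, all observations being independent. For a classifier $f:\mathbb R^d\to\{0,1\}$ put $\mathcal E_0(f)=P_0(f(X)\ne Y)-\inf_g P_0(g(X)\neq Y)$, the infimum being over measurable classifiers $g$. **Class.** Given exponents $\gamma_i>0$ and constants $C_{\gamma_i}>0$ with $\gamma_0=1$, $C_{\gamma_0}=1$, let $\Pi(\alpha,\beta,\gamma,\mu)$, with constants $C_\alpha,C_\beta,c_\mu,r_\mu>0$ and $\mu=(\mu_-,\mu_+)$, be the set of all $(P_0,\dots,P_m)$ such that, with $\Omega=\operatorname{supp}P_0^X$ and $\lambda$ Lebesgue measure: 1. $|\eta_0(x)-\eta_0(x')|\le C_\beta\|x-x'\|^\beta$ for all $x,x'\in\Omega$; 2. $P_0^X(|\eta_0(X)-\tfrac12|\le t)\le C_\alpha t^\alpha$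 for all $t>0$; 3. for every $i$, $P_i^X\ll\lambda$, $\operatorname{supp}P_i^X=\Omega$ and $\mu_-<dP_i^X/d\lambda<\mu_+$ a.e. on $\Omega$; and $\lambda(\Omega\cap B(x,r))\ge c_\mu\lambda(B(x,r))$ for all $x\in\Omega$, $0<r\le r_\mu$; 4. for every $i$, $\eta_i=a_i\eta_0+(1-b_i)(1-\eta_0)$ with $a_i=b_i=\tfrac12\big(1+C_{\gamma_i}|\eta_0-\tfrac12|^{\gamma_i-1}\big)$, that is, $\eta_i-\tfrac12=C_{\gamma_i}|\eta_0-\tfrac12|^{\gamma_i-1}(\eta_0-\tfrac12)$, with values in $[0,1]$ on $\Omega$; if $\gamma_i\ge1$ also $a_i=b_i\in[0,1]$ on $\Omega$. Write $S=\sum_{i=0}^m n_i^{\frac{2\beta+d}{2\gamma_i\beta+d}}$. **Theorem (lower bound).** Let $\alpha\ge0$, $\beta>0$, $\alpha\beta\le d$, $C_\beta>0$, $0<\mu_-<\mu_+$ and $0<t_0\le\tfrac12$. Then there are positive thresholds $C_\alpha^\circ,c_\mu^\circ,r_\mu^\circ$ such that for all $C_\alpha\ge C_\alpha^\circ$, $0<c_\mu\le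 c_\mu^\circ$, $0<r_\mu\le r_\mu^\circ$ and all $0<C_L<C_U<\infty$ there is a constant $c>0$ with the following property. For all $m\ge0$, all sample sizes $n_0,\dots,n_m\ge 0$ and all $\gamma_i,C_{\gamma_i}>0$ with $\gamma_0=C_{\gamma_0}=1$, with $C_{\gamma_i}t_0^{\gamma_i}\le\tfrac12$ for all $i$ and $C_{\gamma_i}t_0^{\gamma_i-1}\le1$ whenever $\gamma_i\ge1$, and with $$C_L<\sum_{i=0}^m\frac{n_i}{S^{\frac{2\gamma_i\beta+d}{2\beta+d}}}<C_U ,$$ one has $$\inf_{\hat f}\ \sup_{(P_0,\dots,P_m)\in\Pi(\alpha,\beta,\gamma,\mu)}\mathbb E\,\mathcal E_0(\hat f)\ \ge\ c\,S^{-\frac{\beta(1+\alpha)}{2\beta+d}},$$ where the infimum is over all (jointly measurable) data-dependent classifiers $\hat f$. In particular $c$ does not depend on $m$, the $n_i$, the $\gamma_i$ or the $C_{\gamma_i}$. -/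

import Mathlib

open MeasureTheory Set
open scoped ENNReal

namespace Crowd

noncomputable section

/-- The feature space `ℝ^d` with its Euclidean norm and Lebesgue measure. -/
abbrev Feat (d : ℕ) : Type := EuclideanSpace ℝ (Fin d)

/-- A labelled observation `(X, Y)`; the label `true` stands for `1` and `false` for `0`. -/
abbrev Obs (d : ℕ) : Type := Feat d × Bool

/-- The constants of the distribution class: margin `(α, C_α)`, smoothness `(β, C_β)`,
and strong density `(μ_-, μ_+)`, `c_μ`, `r_μ`. -/
structure ClassParams where
  α : ℝ
  β : ℝ
  Cα : ℝ
  Cβ : ℝ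
  muMinus : ℝ
  muPlus : ℝ
  cmu : ℝ
  rmu : ℝ

/-- `η` is a version of the regression function `x ↦ P(Y = 1 | X = x)`, with values in `[0, 1]`
on the support of the marginal law of `X` (which is `P.fst`). -/
def IsRegression {d : ℕ} (P : Measure (Obs d)) (η : Feat d → ℝ) : Prop :=
  Measurable η ∧ (∀ x ∈ P.fst.support, η x ∈ Icc (0 : ℝ) 1) ∧
    ∀ A : Set (Feat d), MeasurableSet A →
      P (A ×ˢ {true}) = ∫⁻ x in A, ENNReal.ofReal (η x) ∂P.fst

/-- The common rate `a(x) = b(x)` at which a worker reproduces the true label at a point where the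
true regression function has the value `η`: `(1 + C |η - 1/2|^(γ - 1)) / 2`. -/
def keepRate (γ C η : ℝ) : ℝ := (1 + C * |η - 1 / 2| ^ (γ - 1)) / 2

/-- The worker's regression function `a η + (1 - b)(1 - η)` with `a = b = keepRate`;
it equals `1/2 + C |η - 1/2|^(γ - 1) (η - 1/2)`. -/
def workerReg (γ C η : ℝ) : ℝ :=
  keepRate γ C η * η + (1 - keepRate γ C η) * (1 - η)

theorem workerReg_eq (γ C η : ℝ) :
    workerReg γ C η = 1 / 2 + C * |η - 1 / 2| ^ (γ - 1) * (η - 1 / 2) := by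
  unfold workerReg keepRate
  ring

/-- Common support and strong density. -/
structure StrongDensity {d m : ℕ} (p : ClassParams) (P : Fin (m + 1) → Measure (Obs d)) :
    Prop where
  absCont : ∀ i, (P i).fst ≪ volume
  support_eq : ∀ i, (P i).fst.support = (P 0).fst.support
  regular : ∀ r : ℝ, 0 < r → r ≤ p.rmu → ∀ x ∈ (P 0).fst.support,
    ENNReal.ofReal p.cmu * volume (Metric.closedBall x r)
      ≤ volume ((P 0).fst.support ∩ Metric.closedBall x r)
  density : ∀ i, ∀ᵐ x ∂(volume.restrict (P 0).fst.support),
    ENNReal.ofReal p.muMinus < (P i).fst.rnDeriv volume x ∧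
      (P i).fst.rnDeriv volume x < ENNReal.ofReal p.muPlus

/-- The class `Π(α, β, γ, μ)` of tuples `(P_0, …, P_m)`; `P_0` is the law of the expert data and
the target law, `P_1, …, P_m` are the laws of the workers' data. When `γ_i ≥ 1` the rates
`a_i(x) = b_i(x)` have to be probabilities. For `γ_i < 1` they exceed `1` wherever `η_0` is
close to (but different from) `1/2`, so there only the resulting regression function has to take
values in `[0, 1]`, which is part of `IsRegression`. -/
structure InClass {d m : ℕ} (p : ClassParams) (γ Cγ : Fin (m + 1) → ℝ)
    (P : Fin (m + 1) → Measure (Obs d)) : Prop where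
  prob : ∀ i, IsProbabilityMeasure (P i)
  strong : StrongDensity p P
  exists_reg : ∃ η₀ : Feat d → ℝ, IsRegression (P 0) η₀ ∧
    (∀ x ∈ (P 0).fst.support, ∀ x' ∈ (P 0).fst.support,
      |η₀ x - η₀ x'| ≤ p.Cβ * ‖x - x'‖ ^ p.β) ∧
    (∀ t : ℝ, 0 < t →
      (P 0).fst {x | |η₀ x - 1 / 2| ≤ t} ≤ ENNReal.ofReal (p.Cα * t ^ p.α)) ∧
    ∀ i, IsRegression (P i) (fun x => workerReg (γ i) (Cγ i) (η₀ x)) ∧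
      (1 ≤ γ i → ∀ x ∈ (P 0).fst.support, keepRate (γ i) (Cγ i) (η₀ x) ∈ Icc (0 : ℝ) 1)

/-- Misclassification probability `P(f(X) ≠ Y)`. -/
def risk {d : ℕ} (P : Measure (Obs d)) (f : Feat d → Bool) : ℝ :=
  P.real {z | f z.1 ≠ z.2}

/-- Excess risk over the best (Bayes) classifier. -/
def excessRisk {d : ℕ} (P : Measure (Obs d)) (f : Feat d → Bool) : ℝ :=
  risk P f - ⨅ g : {g : Feat d → Bool // Measurable g}, risk P g.1

/-- A crowdsourced data set: `n i` labelled observations from source `i`. -/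
abbrev Data (d : ℕ) {m : ℕ} (n : Fin (m + 1) → ℕ) : Type :=
  (i : Fin (m + 1)) → Fin (n i) → Obs d

/-- All observations are independent, those of source `i` having law `P i`. -/
def dataLaw {d m : ℕ} (n : Fin (m + 1) → ℕ) (P : Fin (m + 1) → Measure (Obs d)) :
    Measure (Data d n) :=
  Measure.pi fun i => Measure.pi fun _ : Fin (n i) => P i

/-- A data-dependent classifier `\hat f`. -/
def Estimator (d : ℕ) {m : ℕ} (n : Fin (m + 1) → ℕ) : Type :=
  {f : Data d n → Feat d → Bool // Measurable fun q : Data d n × Feat d => f q.1 q.2}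

/-- `E ℰ_0(\hat f)`, the expected excess risk under the target law `P 0`. -/
def expectedExcess {d m : ℕ} {n : Fin (m + 1) → ℕ} (P : Fin (m + 1) → Measure (Obs d))
    (f : Estimator d n) : ℝ≥0∞ :=
  ∫⁻ D, ENNReal.ofReal (excessRisk (P 0) (f.1 D)) ∂(dataLaw n P)

/-- The minimax expected excess risk over the class. -/
def minimaxRisk (d : ℕ) {m : ℕ} (n : Fin (m + 1) → ℕ) (p : ClassParams)
    (γ Cγ : Fin (m + 1) → ℝ) : ℝ≥0∞ :=
  ⨅ f : Estimator d n, ⨆ (P : Fin (m + 1) → Measure (Obs d)) (_ : InClass p γ Cγ P),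
    expectedExcess P f

/-- `∑_{i=0}^m n_i^{(2β+d)/(2γ_iβ+d)}`. -/
def effSize (d : ℕ) (β : ℝ) {m : ℕ} (n : Fin (m + 1) → ℕ) (γ : Fin (m + 1) → ℝ) : ℝ :=
  ∑ i, (n i : ℝ) ^ ((2 * β + d) / (2 * γ i * β + d))

/-- `∑_{i=0}^m n_i / (∑_{j=0}^m n_j^{(2β+d)/(2γ_jβ+d)})^{(2γ_iβ+d)/(2β+d)}`. -/
def sizeRatio (d : ℕ) (β : ℝ) {m : ℕ} (n : Fin (m + 1) → ℕ) (γ : Fin (m + 1) → ℝ) : ℝ :=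
  ∑ i, (n i : ℝ) / effSize d β n γ ^ ((2 * γ i * β + d) / (2 * β + d))

end

end Crowd

namespace Crowd

/-! ### Product measures and Hellinger affinity -/

/-! The proof is Assouad's method at the scale `s ≍ S^(-1/(2β+d))`. About `s^(αβ-d)` disjoint balls
of radius `≍ s` are packed into a cube of side `≍ s^(αβ/d)`; on them `η₀ = 1/2 ± h` with `h = τ s^β`
and free signs. All sources have uniform features on the same region `Ω`.

Flipping one sign exchanges `1/2 + C h^γ` and `1/2 - C h^γ` in the regression function of a source.
Each of its observations then loses at most `4 C² h^(2γ)` times the mass of the ball in Hellinger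
affinity, which is at most `s^(2γβ+d)` because `τ ≤ t₀` and `C t₀^γ ≤ 1/2`. Over the whole sample
the loss is at most `∑ n_i s^(2γ_iβ+d)`, a small multiple of `sizeRatio`, hence at most `1/2`
whatever `m` and the `γ_i` are. No sign can be detected reliably. A wrong sign costs `2h` times the
mass of its ball, and the balls have total mass `≍ s^(αβ)`, so the excess risk is of order
`s^(β(1+α))`.

The geometric difficulty is to place the remaining mass. Smoothness is required on `Ω` only, so `Ω`
may be a union of separated balls with `η₀` constant on each. Balls of radius `R q^k` centred at
distance `4 R q^k` from a corner of the cube, with height `τ q^(kβ)`, fill the scales between the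
cube and `1`. They keep `Ω` regular at all radii up to `R`, and `αβ ≤ d` makes their masses
compatible with the margin condition.

The weight is carried by `eighth_le_overlap`, `assouad`, `Layout.holder`, `Layout.margin` and
`Layout.regular`; `Layout.minimaxRisk_ge` combines them. -/

theorem lintegral_pi_prod {ι : Type*} [Fintype ι] {Ω : ι → Type*} [∀ i, MeasurableSpace (Ω i)]
    (μ : ∀ i, Measure (Ω i)) [∀ i, IsProbabilityMeasure (μ i)] (f : ∀ i, Ω i → ℝ≥0∞)
    (hf : ∀ i, Measurable (f i)) :
    ∫⁻ x, ∏ i, f i (x i) ∂(Measure.pi μ) = ∏ i, ∫⁻ x, f i x ∂(μ i) := by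
  rw [ProbabilityTheory.lintegral_prod_eq_prod_lintegral_of_indepFun Finset.univ
    (fun i (x : ∀ i, Ω i) => f i (x i))
    (ProbabilityTheory.iIndepFun_pi fun i => (hf i).aemeasurable)
    (fun i => (hf i).comp (measurable_pi_apply i))]
  refine Finset.prod_congr rfl fun i _ => ?_
  exact (measurePreserving_eval μ i).lintegral_comp (hf i)

theorem pi_withDensity {ι : Type*} [Fintype ι] {Ω : ι → Type*} [∀ i, MeasurableSpace (Ω i)]
    (μ : ∀ i, Measure (Ω i)) [∀ i, IsProbabilityMeasure (μ i)] (f : ∀ i, Ω i → ℝ≥0∞)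
    (hf : ∀ i, Measurable (f i)) [∀ i, SigmaFinite ((μ i).withDensity (f i))] :
    Measure.pi (fun i => (μ i).withDensity (f i)) =
      (Measure.pi μ).withDensity fun x => ∏ i, f i (x i) := by
  classical
  refine Measure.pi_eq fun s hs => ?_
  have hS : MeasurableSet (univ.pi s) := MeasurableSet.univ_pi hs
  rw [withDensity_apply _ hS, ← lintegral_indicator hS]
  have : ∀ x : ∀ i, Ω i, (univ.pi s).indicator (fun x => ∏ i, f i (x i)) x
      = ∏ i, (s i).indicator (f i) (x i) := by
    intro x
    by_cases hx : x ∈ univ.pi s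
    · rw [indicator_of_mem hx]
      exact Finset.prod_congr rfl fun i _ => (indicator_of_mem (hx i (mem_univ i)) _).symm
    · rw [indicator_of_notMem hx]
      simp only [mem_pi, mem_univ, true_implies, not_forall] at hx
      obtain ⟨i, hi⟩ := hx
      exact (Finset.prod_eq_zero (Finset.mem_univ i) (indicator_of_notMem hi _)).symm
  simp_rw [this]
  rw [lintegral_pi_prod μ _ fun i => (hf i).indicator (hs i)]
  refine Finset.prod_congr rfl fun i _ => ?_
  rw [lintegral_indicator (hs i), withDensity_apply _ (hs i)]

/-- The Hellinger affinity of two probability densities bounds their overlap from below. -/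
theorem affinity_sq_le {α : Type*} [MeasurableSpace α] (μ : Measure α) {p q : α → ℝ≥0∞}
    (hp : Measurable p) (hq : Measurable q) (hp1 : ∫⁻ x, p x ∂μ = 1) (hq1 : ∫⁻ x, q x ∂μ = 1) :
    (∫⁻ x, (p x * q x) ^ (1 / 2 : ℝ) ∂μ) ^ 2 ≤ 2 * ∫⁻ x, min (p x) (q x) ∂μ := by
  have hmin : Measurable fun x => min (p x) (q x) := hp.min hq
  have hmax : Measurable fun x => max (p x) (q x) := hp.max hq
  -- Since `p q = min · max`, Cauchy–Schwarz separates the overlap from the maximum, whose integral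
  -- is at most `2`.
  have hH := ENNReal.lintegral_mul_le_Lp_mul_Lq μ
    (Real.HolderConjugate.two_two) (f := fun x => min (p x) (q x) ^ (1 / 2 : ℝ))
    (g := fun x => max (p x) (q x) ^ (1 / 2 : ℝ))
    (hmin.pow_const _).aemeasurable (hmax.pow_const _).aemeasurable
  have e1 : ∀ x : ℝ≥0∞, (x ^ (1 / 2 : ℝ)) ^ (2 : ℝ) = x := fun x => by
    rw [← ENNReal.rpow_mul]; norm_num
  simp only [Pi.mul_apply, e1] at hH
  have e2 : ∀ x, min (p x) (q x) ^ (1 / 2 : ℝ) * max (p x) (q x) ^ (1 / 2 : ℝ)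
      = (p x * q x) ^ (1 / 2 : ℝ) := fun x => by
    rw [← ENNReal.mul_rpow_of_nonneg _ _ (by norm_num : (0 : ℝ) ≤ 1 / 2), min_mul_max]
  simp only [e2] at hH
  have hmax2 : ∫⁻ x, max (p x) (q x) ∂μ ≤ 2 := by
    calc ∫⁻ x, max (p x) (q x) ∂μ ≤ ∫⁻ x, p x + q x ∂μ :=
          lintegral_mono fun x => max_le le_self_add le_add_self
      _ = 2 := by rw [lintegral_add_left hp, hp1, hq1]; norm_num
  calc (∫⁻ x, (p x * q x) ^ (1 / 2 : ℝ) ∂μ) ^ 2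
      ≤ ((∫⁻ x, min (p x) (q x) ∂μ) ^ (1 / 2 : ℝ)
          * (∫⁻ x, max (p x) (q x) ∂μ) ^ (1 / 2 : ℝ)) ^ 2 := by gcongr
    _ = (∫⁻ x, min (p x) (q x) ∂μ) * ∫⁻ x, max (p x) (q x) ∂μ := by
        rw [mul_pow, ← ENNReal.rpow_two, ← ENNReal.rpow_two, e1, e1]
    _ ≤ (∫⁻ x, min (p x) (q x) ∂μ) * 2 := by gcongr
    _ = _ := mul_comm _ _

/-- Testing two hypotheses: two losses that add up to at least `w` cannot both be small. -/
theorem le_lintegral_withDensity_add {α : Type*} [MeasurableSpace α] (μ : Measure α)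
    {p q F G : α → ℝ≥0∞} (hp : Measurable p) (hq : Measurable q) (hF : Measurable F)
    (hG : Measurable G) {w : ℝ≥0∞} (h : ∀ x, w ≤ F x + G x) :
    w * ∫⁻ x, min (p x) (q x) ∂μ ≤
      ∫⁻ x, F x ∂(μ.withDensity p) + ∫⁻ x, G x ∂(μ.withDensity q) := by
  rw [lintegral_withDensity_eq_lintegral_mul μ hp hF, lintegral_withDensity_eq_lintegral_mul μ hq hG,
    ← lintegral_add_left (hp.mul hF), ← lintegral_const_mul w (hp.min hq)]
  refine lintegral_mono fun x => ?_
  calc w * min (p x) (q x) ≤ (F x + G x) * min (p x) (q x) := by gcongr; exact h x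
    _ = min (p x) (q x) * F x + min (p x) (q x) * G x := by ring
    _ ≤ p x * F x + q x * G x := by
        gcongr
        · exact min_le_left _ _
        · exact min_le_right _ _

/-- This is `∏ (1 - ε i) ≥ 1 - ∑ ε i` in a form free of truncated subtraction. A factor may exceed
`1`, so the induction step truncates it at `1` to keep the coefficient of the remaining sum bounded.
-/
theorem one_le_prod_add_sum {ι : Type*} (s : Finset ι) (a ε : ι → ℝ≥0∞)
    (h : ∀ i ∈ s, 1 ≤ a i + ε i) : 1 ≤ ∏ i ∈ s, a i + ∑ i ∈ s, ε i := by
  classical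
  induction s using Finset.induction_on with
  | empty => simp
  | insert j s hj ih =>
    rw [Finset.prod_insert hj, Finset.sum_insert hj]
    have ih := ih fun i hi => h i (Finset.mem_insert_of_mem hi)
    have hj := h j (Finset.mem_insert_self j s)
    set b := min (a j) 1 with hb
    have hb1 : 1 ≤ b + ε j := by
      rw [hb, min_add]
      exact le_min hj le_self_add
    have hbl : b ≤ 1 := min_le_right _ _
    calc (1 : ℝ≥0∞) ≤ b * 1 + ε j := by rwa [mul_one]
      _ ≤ b * (∏ i ∈ s, a i + ∑ i ∈ s, ε i) + ε j := by gcongr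
      _ = b * ∏ i ∈ s, a i + (ε j + b * ∑ i ∈ s, ε i) := by ring
      _ ≤ a j * ∏ i ∈ s, a i + (ε j + 1 * ∑ i ∈ s, ε i) := by
          gcongr
          exact min_le_left _ _
      _ = _ := by rw [one_mul]

/-! ### Laws with a prescribed marginal and regression function -/

noncomputable section

/-- The uniform law on the labels. -/
def fairLabel : Measure Bool := (2⁻¹ : ℝ≥0∞) • Measure.count

instance : IsProbabilityMeasure fairLabel := by
  constructor
  simp [fairLabel, Measure.count_apply_finite, ENNReal.inv_mul_cancel]

/-- The density, relative to fair labels, of a law with regression function `η`. -/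
def labelDensity {d : ℕ} (η : Feat d → ℝ) (z : Obs d) : ℝ≥0∞ :=
  2 * ENNReal.ofReal (if z.2 then η z.1 else 1 - η z.1)

/-- The law of `(X, Y)` with marginal `μ` and regression function `η`. -/
def obsLaw {d : ℕ} (μ : Measure (Feat d)) (η : Feat d → ℝ) : Measure (Obs d) :=
  (μ.prod fairLabel).withDensity (labelDensity η)

theorem measurable_labelDensity {d : ℕ} {η : Feat d → ℝ} (hη : Measurable η) :
    Measurable (labelDensity η) := by
  unfold labelDensity
  refine Measurable.const_mul (ENNReal.measurable_ofReal.comp ?_) 2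
  exact Measurable.ite (measurable_snd (measurableSet_singleton true)) (hη.comp measurable_fst)
    (measurable_const.sub (hη.comp measurable_fst))

theorem lintegral_prod_fairLabel {d : ℕ} (μ : Measure (Feat d)) [SFinite μ] {F : Obs d → ℝ≥0∞}
    (hF : Measurable F) :
    ∫⁻ z, F z ∂(μ.prod fairLabel) = ∫⁻ x, 2⁻¹ * (F (x, true) + F (x, false)) ∂μ := by
  rw [lintegral_prod _ hF.aemeasurable]
  refine lintegral_congr fun x => ?_
  simp [fairLabel, lintegral_fintype, mul_comm, mul_add]

theorem lintegral_obsLaw {d : ℕ} (μ : Measure (Feat d)) [SFinite μ] {η : Feat d → ℝ}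
    (hη : Measurable η) {F : Obs d → ℝ≥0∞} (hF : Measurable F) :
    ∫⁻ z, F z ∂(obsLaw μ η) =
      ∫⁻ x, (ENNReal.ofReal (η x) * F (x, true) + ENNReal.ofReal (1 - η x) * F (x, false)) ∂μ := by
  have hL := measurable_labelDensity hη
  rw [obsLaw, lintegral_withDensity_eq_lintegral_mul _ hL hF,
    lintegral_prod_fairLabel μ (hL.mul hF)]
  refine lintegral_congr fun x => ?_
  simp only [labelDensity, Pi.mul_apply, if_true, Bool.false_eq_true, if_false]
  rw [mul_add, mul_assoc, mul_assoc, ← mul_assoc, ← mul_assoc (2⁻¹) 2,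
    ENNReal.inv_mul_cancel two_ne_zero ENNReal.ofNat_ne_top, one_mul, one_mul]

theorem obsLaw_apply {d : ℕ} (μ : Measure (Feat d)) [SFinite μ] {η : Feat d → ℝ}
    (hη : Measurable η) {s : Set (Obs d)} (hs : MeasurableSet s) :
    obsLaw μ η s = ∫⁻ x, (ENNReal.ofReal (η x) * s.indicator 1 (x, true)
      + ENNReal.ofReal (1 - η x) * s.indicator 1 (x, false)) ∂μ := by
  rw [← lintegral_obsLaw μ hη (measurable_one.indicator hs), lintegral_indicator_one hs]

theorem ofReal_add_ofReal_one_sub {t : ℝ} (ht : t ∈ Icc (0 : ℝ) 1) :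
    ENNReal.ofReal t + ENNReal.ofReal (1 - t) = 1 := by
  rw [← ENNReal.ofReal_add ht.1 (sub_nonneg.2 ht.2)]
  simp

theorem obsLaw_fst {d : ℕ} (μ : Measure (Feat d)) [SFinite μ] {η : Feat d → ℝ}
    (hη : Measurable η) (h01 : ∀ x, η x ∈ Icc (0 : ℝ) 1) : (obsLaw μ η).fst = μ := by
  ext s hs
  rw [Measure.fst_apply hs, obsLaw_apply μ hη (measurable_fst hs), ← lintegral_indicator_one hs]
  refine lintegral_congr fun x => ?_
  have e : ∀ y : Bool, (Prod.fst ⁻¹' s : Set (Obs d)).indicator (1 : Obs d → ℝ≥0∞) (x, y)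
      = s.indicator 1 x := fun y => by by_cases hx : x ∈ s <;> simp [hx]
  rw [e, e, ← add_mul, ofReal_add_ofReal_one_sub (h01 x), one_mul]

theorem obsLaw_isProbabilityMeasure {d : ℕ} (μ : Measure (Feat d)) [IsProbabilityMeasure μ]
    {η : Feat d → ℝ} (hη : Measurable η) (h01 : ∀ x, η x ∈ Icc (0 : ℝ) 1) :
    IsProbabilityMeasure (obsLaw μ η) := by
  constructor
  rw [← Measure.fst_univ, obsLaw_fst μ hη h01, measure_univ]

theorem obsLaw_isRegression {d : ℕ} (μ : Measure (Feat d)) [SFinite μ] {η : Feat d → ℝ}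
    (hη : Measurable η) (h01 : ∀ x, η x ∈ Icc (0 : ℝ) 1) : IsRegression (obsLaw μ η) η := by
  refine ⟨hη, fun x _ => h01 x, fun A hA => ?_⟩
  rw [obsLaw_fst μ hη h01, obsLaw_apply μ hη (hA.prod (measurableSet_singleton true)),
    ← lintegral_indicator hA]
  refine lintegral_congr fun x => ?_
  by_cases hx : x ∈ A <;> simp [hx]

/-! ### Likelihood of the data -/

/-- The reference law of a data set: features from `μ`, fair labels. -/
def dataBase {d m : ℕ} (n : Fin (m + 1) → ℕ) (μ : Measure (Feat d)) : Measure (Data d n) :=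
  Measure.pi fun i => Measure.pi fun _ : Fin (n i) => μ.prod fairLabel

/-- The likelihood of a data set under the regression functions `η i`. -/
def likelihood {d m : ℕ} {n : Fin (m + 1) → ℕ} (η : Fin (m + 1) → Feat d → ℝ) (D : Data d n) :
    ℝ≥0∞ :=
  ∏ i, ∏ k, labelDensity (η i) (D i k)

theorem measurable_likelihood {d m : ℕ} {n : Fin (m + 1) → ℕ} {η : Fin (m + 1) → Feat d → ℝ}
    (hη : ∀ i, Measurable (η i)) : Measurable (likelihood (n := n) η) := by
  refine Finset.measurable_prod _ fun i _ => Finset.measurable_prod _ fun k _ => ?_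
  exact (measurable_labelDensity (hη i)).comp
    ((measurable_pi_apply k).comp (measurable_pi_apply i))

theorem dataLaw_obsLaw {d m : ℕ} (n : Fin (m + 1) → ℕ) (μ : Measure (Feat d))
    [IsProbabilityMeasure μ] {η : Fin (m + 1) → Feat d → ℝ} (hη : ∀ i, Measurable (η i))
    (h01 : ∀ i x, η i x ∈ Icc (0 : ℝ) 1) :
    dataLaw n (fun i => obsLaw μ (η i)) = (dataBase n μ).withDensity (likelihood η) := by
  have hprob : ∀ i, IsProbabilityMeasure ((μ.prod fairLabel).withDensity (labelDensity (η i))) :=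
    fun i => obsLaw_isProbabilityMeasure μ (hη i) (h01 i)
  have inner : ∀ i, Measure.pi (fun _ : Fin (n i) => obsLaw μ (η i)) =
      (Measure.pi fun _ : Fin (n i) => μ.prod fairLabel).withDensity
        fun x => ∏ k, labelDensity (η i) (x k) := fun i =>
    pi_withDensity (fun _ : Fin (n i) => μ.prod fairLabel) (fun _ => labelDensity (η i))
      fun _ => measurable_labelDensity (hη i)
  have hs : ∀ i, SigmaFinite ((Measure.pi fun _ : Fin (n i) => μ.prod fairLabel).withDensity
        fun x => ∏ k, labelDensity (η i) (x k)) := fun i => by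
    have : IsProbabilityMeasure (obsLaw μ (η i)) := hprob i
    rw [← inner i]
    infer_instance
  unfold dataLaw dataBase
  simp_rw [inner]
  exact pi_withDensity (fun i => Measure.pi fun _ : Fin (n i) => μ.prod fairLabel)
    (fun i x => ∏ k, labelDensity (η i) (x k)) fun i =>
      Finset.measurable_prod _ fun k _ =>
        (measurable_labelDensity (hη i)).comp (measurable_pi_apply k)

theorem lintegral_likelihood {d m : ℕ} (n : Fin (m + 1) → ℕ) (μ : Measure (Feat d))
    [IsProbabilityMeasure μ] {η : Fin (m + 1) → Feat d → ℝ} (hη : ∀ i, Measurable (η i))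
    (h01 : ∀ i x, η i x ∈ Icc (0 : ℝ) 1) :
    ∫⁻ D, likelihood η D ∂(dataBase n μ) = 1 := by
  have hprob : ∀ i, IsProbabilityMeasure (obsLaw μ (η i)) :=
    fun i => obsLaw_isProbabilityMeasure μ (hη i) (h01 i)
  have : (dataLaw n fun i => obsLaw μ (η i)) univ = 1 := by
    unfold dataLaw
    exact measure_univ
  rwa [dataLaw_obsLaw n μ hη h01, withDensity_apply _ MeasurableSet.univ,
    Measure.restrict_univ] at this

/-- Affinity of two observations whose regression functions are `1/2 + s` and `1/2 - s` on `B`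
and agree elsewhere. -/
theorem one_le_label_affinity {d : ℕ} (μ : Measure (Feat d)) [IsProbabilityMeasure μ]
    {η η' : Feat d → ℝ} (hη : Measurable η) (hη' : Measurable η')
    (h01 : ∀ x, η x ∈ Icc (0 : ℝ) 1) {B : Set (Feat d)}
    (hB : MeasurableSet B) {s : ℝ} (h1 : ∀ x ∈ B, η x = 1 / 2 + s) (h2 : ∀ x ∈ B, η' x = 1 / 2 - s)
    (h3 : ∀ x ∉ B, η' x = η x) :
    1 ≤ ∫⁻ z, (labelDensity η z * labelDensity η' z) ^ (1 / 2 : ℝ) ∂(μ.prod fairLabel)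
      + ENNReal.ofReal (4 * s ^ 2) * μ B := by
  have half : (0 : ℝ) ≤ 1 / 2 := by norm_num
  have sq : ∀ a : ℝ≥0∞, (a * a) ^ (1 / 2 : ℝ) = a := fun a => by
    rw [ENNReal.mul_rpow_of_nonneg _ _ half, ← ENNReal.rpow_add_of_nonneg _ _ half half]
    norm_num
  have hm : Measurable fun z => (labelDensity η z * labelDensity η' z) ^ (1 / 2 : ℝ) :=
    ((measurable_labelDensity hη).mul (measurable_labelDensity hη')).pow_const _
  rw [lintegral_prod_fairLabel μ hm, ← lintegral_indicator_const hB, ← lintegral_add_right _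
    (measurable_const.indicator hB)]
  calc (1 : ℝ≥0∞) = ∫⁻ _, 1 ∂μ := by simp
    _ ≤ _ := lintegral_mono fun x => ?_
  have two : ∀ a b : ℝ≥0∞, (2 * a * (2 * b)) ^ (1 / 2 : ℝ) = 2 * (a * b) ^ (1 / 2 : ℝ) := by
    intro a b
    rw [show 2 * a * (2 * b) = 2 * 2 * (a * b) by ring, ENNReal.mul_rpow_of_nonneg _ _ half, sq]
  simp only [labelDensity, if_true, Bool.false_eq_true, if_false, two]
  rw [← mul_add, ← mul_assoc, ENNReal.inv_mul_cancel two_ne_zero ENNReal.ofNat_ne_top, one_mul]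
  by_cases hx : x ∈ B
  · have hs := h01 x
    rw [h1 x hx] at hs
    have hs1 : s ^ 2 ≤ 1 / 4 := by nlinarith [hs.1, hs.2]
    rw [indicator_of_mem hx, h1 x hx, h2 x hx, ← ENNReal.ofReal_mul hs.1,
      ← ENNReal.ofReal_mul (by linarith [hs.2]),
      show (1 - (1 / 2 + s)) * (1 - (1 / 2 - s)) = (1 / 2 + s) * (1 / 2 - s) by ring,
      show (1 / 2 + s) * (1 / 2 - s) = 1 / 4 - s ^ 2 by ring,
      ENNReal.ofReal_rpow_of_nonneg (by linarith) half, ← Real.sqrt_eq_rpow,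
      ← ENNReal.ofReal_add (Real.sqrt_nonneg _) (Real.sqrt_nonneg _),
      ← ENNReal.ofReal_add (by positivity) (by positivity), ← ENNReal.ofReal_one]
    refine ENNReal.ofReal_le_ofReal ?_
    -- After squaring this is `4 s⁴ ≤ s²`, which is `hs1`.
    have : 1 / 2 - 2 * s ^ 2 ≤ √(1 / 4 - s ^ 2) := by
      refine Real.le_sqrt_of_sq_le ?_
      nlinarith [sq_nonneg s]
    linarith
  · rw [indicator_of_notMem hx, add_zero, h3 x hx, sq, sq, ofReal_add_ofReal_one_sub (h01 x)]

/-- Overlap of the laws of two data sets whose regression functions differ on `B` only. -/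
theorem eighth_le_overlap {d m : ℕ} (n : Fin (m + 1) → ℕ) (μ : Measure (Feat d))
    [IsProbabilityMeasure μ] {η η' : Fin (m + 1) → Feat d → ℝ} (hη : ∀ i, Measurable (η i))
    (hη' : ∀ i, Measurable (η' i)) (h01 : ∀ i x, η i x ∈ Icc (0 : ℝ) 1)
    (h01' : ∀ i x, η' i x ∈ Icc (0 : ℝ) 1) {B : Set (Feat d)} (hB : MeasurableSet B)
    {s : Fin (m + 1) → ℝ} (h1 : ∀ i, ∀ x ∈ B, η i x = 1 / 2 + s i)
    (h2 : ∀ i, ∀ x ∈ B, η' i x = 1 / 2 - s i) (h3 : ∀ i, ∀ x ∉ B, η' i x = η i x)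
    (hinfo : ∑ i, (n i : ℝ≥0∞) * (ENNReal.ofReal (4 * s i ^ 2) * μ B) ≤ 2⁻¹) :
    8⁻¹ ≤ ∫⁻ D, min (likelihood η D) (likelihood η' D) ∂(dataBase n μ) := by
  have haff := affinity_sq_le (dataBase n μ) (measurable_likelihood (n := n) hη)
    (measurable_likelihood hη') (lintegral_likelihood n μ hη h01) (lintegral_likelihood n μ hη' h01')
  set a : Fin (m + 1) → ℝ≥0∞ := fun i => ∫⁻ z, (labelDensity (η i) z * labelDensity (η' i) z)
    ^ (1 / 2 : ℝ) ∂(μ.prod fairLabel) with ha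
  have hm : ∀ i, Measurable fun z => (labelDensity (η i) z * labelDensity (η' i) z)
    ^ (1 / 2 : ℝ) := fun i =>
      ((measurable_labelDensity (hη i)).mul (measurable_labelDensity (hη' i))).pow_const _
  have hprod : ∫⁻ D, (likelihood η D * likelihood η' D) ^ (1 / 2 : ℝ) ∂(dataBase n μ)
      = ∏ i, ∏ _k : Fin (n i), a i := by
    have e : ∀ D : Data d n, (likelihood η D * likelihood η' D) ^ (1 / 2 : ℝ)
        = ∏ i, ∏ k, (labelDensity (η i) (D i k) * labelDensity (η' i) (D i k)) ^ (1 / 2 : ℝ) := by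
      intro D
      simp_rw [ENNReal.prod_rpow_of_nonneg (by norm_num : (0 : ℝ) ≤ 1 / 2), likelihood,
        Finset.prod_mul_distrib]
    simp_rw [e]
    unfold dataBase
    rw [lintegral_pi_prod (fun i => Measure.pi fun _ : Fin (n i) => μ.prod fairLabel)
      (fun i x => ∏ k, (labelDensity (η i) (x k) * labelDensity (η' i) (x k)) ^ (1 / 2 : ℝ))
      fun i => Finset.measurable_prod _ fun k _ => (hm i).comp (measurable_pi_apply k)]
    refine Finset.prod_congr rfl fun i _ => ?_
    exact lintegral_pi_prod (fun _ : Fin (n i) => μ.prod fairLabel) _ fun _ => hm i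
  have hone : 1 ≤ ∏ i, ∏ _k : Fin (n i), a i
      + ∑ i, (n i : ℝ≥0∞) * (ENNReal.ofReal (4 * s i ^ 2) * μ B) := by
    refine one_le_prod_add_sum _ _ _ fun i _ => ?_
    have := one_le_prod_add_sum (Finset.univ : Finset (Fin (n i))) (fun _ => a i)
      (fun _ => ENNReal.ofReal (4 * s i ^ 2) * μ B) fun _ _ =>
        one_le_label_affinity μ (hη i) (hη' i) (h01 i) hB (h1 i) (h2 i) (h3 i)
    simpa using this
  rw [hprod] at haff
  -- The affinity of the products is at least `1/2`, so the overlap is at least `(1/2)² / 2`.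
  have hhalf : 2⁻¹ ≤ ∏ i, ∏ _k : Fin (n i), a i := by
    have : 2⁻¹ + (2⁻¹ : ℝ≥0∞) ≤ ∏ i, ∏ _k : Fin (n i), a i + 2⁻¹ := by
      rw [ENNReal.inv_two_add_inv_two]
      exact hone.trans (by gcongr)
    exact (ENNReal.add_le_add_iff_right (by simp)).1 this
  have h4 : (2⁻¹ : ℝ≥0∞) ^ 2 ≤ 2 * ∫⁻ D, min (likelihood η D) (likelihood η' D) ∂(dataBase n μ) :=
    le_trans (by gcongr) haff
  calc (8⁻¹ : ℝ≥0∞) = 2⁻¹ * (2⁻¹ : ℝ≥0∞) ^ 2 := by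
        rw [← pow_succ', ← ENNReal.inv_pow]; norm_num
    _ ≤ 2⁻¹ * (2 * ∫⁻ D, min (likelihood η D) (likelihood η' D) ∂(dataBase n μ)) := by gcongr
    _ = _ := by
        rw [← mul_assoc, ENNReal.inv_mul_cancel two_ne_zero ENNReal.ofNat_ne_top, one_mul]

/-! ### Excess risk -/

theorem risk_obsLaw {d : ℕ} (μ : Measure (Feat d)) [SFinite μ] {η : Feat d → ℝ}
    (hη : Measurable η) {f : Feat d → Bool} (hf : Measurable f) :
    obsLaw μ η {z | f z.1 ≠ z.2} =
      ∫⁻ x, ENNReal.ofReal (if f x then 1 - η x else η x) ∂μ := by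
  have hs : MeasurableSet {z : Obs d | f z.1 ≠ z.2} :=
    (measurableSet_eq_fun (hf.comp measurable_fst) measurable_snd).compl
  rw [obsLaw_apply μ hη hs]
  refine lintegral_congr fun x => ?_
  cases h : f x <;> simp [indicator, h]

/-- If the regression function is `1/2 ± h` on the disjoint sets `B j`, then a classifier pays `2 h`
wherever it disagrees there with the sign. -/
theorem sum_le_excessRisk {d : ℕ} (μ : Measure (Feat d)) [IsProbabilityMeasure μ] {η : Feat d → ℝ}
    (hη : Measurable η) (h01 : ∀ x, η x ∈ Icc (0 : ℝ) 1) {ι : Type*} [Fintype ι]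
    {B : ι → Set (Feat d)} (hB : ∀ j, MeasurableSet (B j)) (hd : Pairwise fun i j => Disjoint (B i) (B j))
    {h : ℝ} (hh : 0 < h) {σ : ι → Bool}
    (hσ : ∀ j, ∀ x ∈ B j, η x = 1 / 2 + if σ j then h else -h)
    {f : Feat d → Bool} (hf : Measurable f) :
    ∑ j, ENNReal.ofReal (2 * h) * μ (B j ∩ {x | f x ≠ σ j})
      ≤ ENNReal.ofReal (excessRisk (obsLaw μ η) f) := by
  classical
  have hprob := obsLaw_isProbabilityMeasure μ hη h01
  -- The Bayes rule enters as one competitor in the infimum, so a lower bound on `risk f - risk g`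
  -- suffices. It is compared with `f` pointwise, which also covers the points outside all `B j`.
  set g : Feat d → Bool := fun x => decide (1 / 2 < η x) with hg_def
  have hg : Measurable g := by
    refine measurable_to_bool ?_
    have : g ⁻¹' {true} = {x | 1 / 2 < η x} := by ext; simp [hg_def]
    rw [this]
    exact measurableSet_lt measurable_const hη
  have hmE : ∀ j, MeasurableSet (B j ∩ {x | f x ≠ σ j}) := fun j =>
    (hB j).inter (measurableSet_eq_fun hf measurable_const).compl
  have key : obsLaw μ η {z | g z.1 ≠ z.2} +
      ∑ j, ENNReal.ofReal (2 * h) * μ (B j ∩ {x | f x ≠ σ j}) ≤ obsLaw μ η {z | f z.1 ≠ z.2} := by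
    rw [risk_obsLaw μ hη hf, risk_obsLaw μ hη hg]
    simp_rw [← lintegral_indicator_const (hmE _)]
    rw [← lintegral_finsetSum _ fun j _ => measurable_const.indicator (hmE j),
      ← lintegral_add_right _ (Finset.measurable_sum _ fun j _ =>
        measurable_const.indicator (hmE j))]
    refine lintegral_mono fun x => ?_
    have hx01 := h01 x
    have hbase : ENNReal.ofReal (if g x then 1 - η x else η x)
        ≤ ENNReal.ofReal (if f x then 1 - η x else η x) := by
      refine ENNReal.ofReal_le_ofReal ?_
      by_cases hgx : 1 / 2 < η x
      · have : g x = true := by simp only [hg_def, hgx, decide_true]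
        rw [this]
        cases f x <;> simp; linarith
      · have : g x = false := by simp only [hg_def, hgx, decide_false]
        rw [this]
        cases f x <;> simp; linarith
    by_cases hx : ∃ j, x ∈ B j ∩ {x | f x ≠ σ j}
    · obtain ⟨j, hj⟩ := hx
      have hz : ∀ i ∈ Finset.univ, i ≠ j → (B i ∩ {x | f x ≠ σ i}).indicator
          (fun _ => ENNReal.ofReal (2 * h)) x = 0 := fun i _ hij =>
        indicator_of_notMem (fun hi => (disjoint_left.1 (hd hij)) hi.1 hj.1) _
      rw [Finset.sum_eq_single j hz (by simp), indicator_of_mem hj]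
      have e := hσ j x hj.1
      have hfx : f x ≠ σ j := hj.2
      rw [← ENNReal.ofReal_add (by split_ifs <;> linarith [hx01.1, hx01.2]) (by positivity)]
      refine ENNReal.ofReal_le_ofReal ?_
      cases hs : σ j
      · have h1 : f x = true := by simpa [hs] using hfx
        have h2 : g x = false := by
          simp only [hg_def, decide_eq_false_iff_not, e, hs, Bool.false_eq_true, if_false]
          linarith
        rw [h1, h2]
        simp only [e, hs, Bool.false_eq_true, if_false, if_true]
        linarith
      · have h1 : f x = false := by simpa [hs] using hfx
        have h2 : g x = true := by
          simp only [hg_def, decide_eq_true_eq, e, hs, if_true]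
          linarith
        rw [h1, h2]
        simp only [e, hs, Bool.false_eq_true, if_false, if_true]
        linarith
    · push Not at hx
      rw [Finset.sum_eq_zero fun j _ => indicator_of_notMem (hx j) _, add_zero]
      exact hbase
  have hinf : (⨅ g : {g : Feat d → Bool // Measurable g}, risk (obsLaw μ η) g.1)
      ≤ risk (obsLaw μ η) g :=
    ciInf_le ⟨0, by rintro _ ⟨g, rfl⟩; exact measureReal_nonneg⟩ (⟨g, hg⟩ : {g // Measurable g})
  have hfin : obsLaw μ η {z | f z.1 ≠ z.2} ≠ ∞ := measure_ne_top _ _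
  calc ∑ j, ENNReal.ofReal (2 * h) * μ (B j ∩ {x | f x ≠ σ j})
      ≤ obsLaw μ η {z | f z.1 ≠ z.2} - obsLaw μ η {z | g z.1 ≠ z.2} :=
        ENNReal.le_sub_of_add_le_left (measure_ne_top _ _) key
    _ = ENNReal.ofReal (risk (obsLaw μ η) f - risk (obsLaw μ η) g) := by
        rw [risk, risk, ENNReal.ofReal_sub _ measureReal_nonneg, ofReal_measureReal,
          ofReal_measureReal]
    _ ≤ _ := ENNReal.ofReal_le_ofReal (by unfold excessRisk; linarith)

/-! ### Assouad's lemma -/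

/-- The excess risk splits into one loss per ball. Flipping the `j`-th sign is an involution of the
sign cube, and the two laws it pairs overlap by at least `1/8`, so their `j`-th losses add up to at
least a multiple of `w / 8`. Averaging over the cube bounds the mean risk, and some `σ` is at least
as bad as the mean. -/
theorem assouad {d m : ℕ} (n : Fin (m + 1) → ℕ) (μ : Measure (Feat d)) [IsProbabilityMeasure μ]
    {ι : Type*} [Fintype ι] [DecidableEq ι] {B : ι → Set (Feat d)}
    (hB : ∀ j, MeasurableSet (B j)) (hd : Pairwise fun i j => Disjoint (B i) (B j))
    {w : ℝ≥0∞} (hw : ∀ j, μ (B j) = w) {η : (ι → Bool) → Fin (m + 1) → Feat d → ℝ}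
    (hη : ∀ σ i, Measurable (η σ i)) (h01 : ∀ σ i x, η σ i x ∈ Icc (0 : ℝ) 1)
    {θ : Fin (m + 1) → ℝ} (hθ : 0 < θ 0)
    (hηB : ∀ σ i j, ∀ x ∈ B j, η σ i x = 1 / 2 + if σ j then θ i else -θ i)
    (hflip : ∀ σ i j, ∀ x ∉ B j, η (Function.update σ j (!σ j)) i x = η σ i x)
    (hinfo : ∑ i, (n i : ℝ≥0∞) * (ENNReal.ofReal (4 * θ i ^ 2) * w) ≤ 2⁻¹) (f : Estimator d n) :
    ∃ σ, ENNReal.ofReal (θ 0) * (Fintype.card ι * w) * 8⁻¹ ≤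
      expectedExcess (fun i => obsLaw μ (η σ i)) f := by
  set c : ℝ≥0∞ := ENNReal.ofReal (2 * θ 0) with hc
  set E : (ι → Bool) → ι → ℝ≥0∞ := fun σ j =>
    ∫⁻ D, μ (B j ∩ {x | f.1 D x ≠ σ j}) ∂(dataLaw n fun i => obsLaw μ (η σ i)) with hE
  have hsect : ∀ j (s : Bool), Measurable fun D : Data d n => μ (B j ∩ {x | f.1 D x ≠ s}) := by
    intro j s
    have hs : MeasurableSet {q : Data d n × Feat d | q.2 ∈ B j ∧ f.1 q.1 q.2 ≠ s} :=
      (measurable_snd (hB j)).inter (measurableSet_eq_fun f.2 measurable_const).compl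
    exact measurable_measure_prodMk_left hs
  have hlow : ∀ σ, ∑ j, c * E σ j ≤ expectedExcess (fun i => obsLaw μ (η σ i)) f := by
    intro σ
    simp_rw [hE, ← lintegral_const_mul c (hsect _ _)]
    rw [← lintegral_finsetSum _ fun j _ => (hsect j (σ j)).const_mul c]
    refine lintegral_mono fun D => ?_
    exact sum_le_excessRisk μ (hη σ 0) (h01 σ 0) hB hd hθ (hηB σ 0)
      (f.2.comp measurable_prodMk_left)
  have hpair : ∀ σ j, w * 8⁻¹ ≤ E σ j + E (Function.update σ j (!σ j)) j := by
    intro σ j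
    set σ' := Function.update σ j (!σ j) with hσ'
    have hσj : σ' j = !σ j := by simp [hσ']
    have hov : (8⁻¹ : ℝ≥0∞) ≤ ∫⁻ D, min (likelihood (η σ) D) (likelihood (η σ') D)
        ∂(dataBase n μ) := by
      refine eighth_le_overlap n μ (hη σ) (hη σ') (h01 σ) (h01 σ') (hB j)
        (s := fun i => if σ j then θ i else -θ i) (fun i x hx => hηB σ i j x hx)
        (fun i x hx => ?_) (fun i x hx => hflip σ i j x hx) ?_
      · rw [hηB σ' i j x hx, hσj]
        cases σ j <;> simp [sub_eq_add_neg]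
      · rw [hw j]
        refine le_of_eq_of_le (Finset.sum_congr rfl fun i _ => ?_) hinfo
        cases σ j <;> simp
    -- A label chosen at a point of `B j` is wrong for one of the two signs, so the two error sets
    -- cover `B j`.
    have h2 := le_lintegral_withDensity_add (dataBase n μ) (measurable_likelihood (n := n) (hη σ))
      (measurable_likelihood (hη σ')) (hsect j (σ j)) (hsect j (σ' j)) (w := w) (fun D => by
        rw [← hw j]
        refine (measure_mono fun x hx => ?_).trans (measure_union_le _ _)
        simp only [mem_union, mem_inter_iff, hx, true_and, mem_ofPred_eq, hσj]
        cases f.1 D x <;> cases σ j <;> simp)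
    rw [← dataLaw_obsLaw n μ (hη σ) (h01 σ), ← dataLaw_obsLaw n μ (hη σ') (h01 σ')] at h2
    exact le_trans (by gcongr) h2
  by_contra! hcon
  have hsum : ∑ σ : ι → Bool, ∑ j, c * E σ j
      < ∑ _σ : ι → Bool, ENNReal.ofReal (θ 0) * (Fintype.card ι * w) * 8⁻¹ :=
    ENNReal.sum_lt_sum_of_nonempty Finset.univ_nonempty fun σ _ => (hlow σ).trans_lt (hcon σ)
  refine absurd hsum (not_lt.2 ?_)
  have hinv : ∀ j, Function.Involutive fun σ : ι → Bool => Function.update σ j (!σ j) := by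
    intro j σ
    simp
  have hc2 : c = 2 * ENNReal.ofReal (θ 0) := by
    rw [hc, ENNReal.ofReal_mul two_pos.le, ENNReal.ofReal_ofNat]
  have hj : ∀ j, ∑ _σ : ι → Bool, ENNReal.ofReal (θ 0) * (w * 8⁻¹) ≤ ∑ σ, c * E σ j := by
    intro j
    have e : ∑ σ, E σ j = ∑ σ, E (Function.update σ j (!σ j)) j :=
      (Equiv.sum_comp (hinv j).toPerm fun σ => E σ j).symm
    calc ∑ _σ : ι → Bool, ENNReal.ofReal (θ 0) * (w * 8⁻¹)
        ≤ ∑ σ : ι → Bool, ENNReal.ofReal (θ 0) * (E σ j + E (Function.update σ j (!σ j)) j) := by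
          gcongr with σ
          exact hpair σ j
      _ = ∑ σ, c * E σ j := by
          rw [← Finset.mul_sum, ← Finset.mul_sum, Finset.sum_add_distrib, ← e, hc2]
          ring
  rw [Finset.sum_comm]
  refine le_trans (le_of_eq ?_) (Finset.sum_le_sum fun j _ => hj j)
  simp only [Finset.sum_const, Finset.card_univ, nsmul_eq_mul]
  ring

/-! ### Worker regression functions -/

theorem workerReg_one (η : ℝ) : workerReg 1 1 η = η := by
  rw [workerReg_eq]
  simp

theorem workerReg_half_add {γ C h : ℝ} (hh : 0 < h) :
    workerReg γ C (1 / 2 + h) = 1 / 2 + C * h ^ γ := by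
  rw [workerReg_eq, add_sub_cancel_left, abs_of_pos hh, mul_assoc,
    ← Real.rpow_add_one hh.ne', sub_add_cancel]

theorem workerReg_half_sub {γ C h : ℝ} (hh : 0 < h) :
    workerReg γ C (1 / 2 + -h) = 1 / 2 + -(C * h ^ γ) := by
  rw [workerReg_eq, add_sub_cancel_left, abs_neg, abs_of_pos hh, mul_neg, mul_assoc,
    ← Real.rpow_add_one hh.ne', sub_add_cancel]

theorem workerReg_mem_Icc {γ C t η : ℝ} (hγ : 0 < γ) (hC : 0 < C) (ht : C * t ^ γ ≤ 1 / 2)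
    (hη : |η - 1 / 2| ≤ t) : workerReg γ C η ∈ Icc (0 : ℝ) 1 := by
  have key : ∀ h, 0 < h → h ≤ t → 0 ≤ C * h ^ γ ∧ C * h ^ γ ≤ 1 / 2 := fun h h0 ht' =>
    ⟨by positivity, le_trans (by gcongr) ht⟩
  rcases lt_trichotomy (η - 1 / 2) 0 with h | h | h
  · rw [abs_of_neg h] at hη
    have := key _ (neg_pos.2 h) hη
    rw [show η = 1 / 2 + -(-(η - 1 / 2)) by ring, workerReg_half_sub (neg_pos.2 h)]
    constructor <;> linarith [this.1, this.2]
  -- The factor `η - 1/2` vanishes, so the value given to `0 ^ (γ - 1)` is immaterial.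
  · rw [workerReg_eq, h]
    norm_num
  · rw [abs_of_pos h] at hη
    have := key _ h hη
    rw [show η = 1 / 2 + (η - 1 / 2) by ring, workerReg_half_add h]
    constructor <;> linarith [this.1, this.2]

theorem keepRate_mem_Icc {γ C t η : ℝ} (hγ : 1 ≤ γ) (hC : 0 < C) (ht : C * t ^ (γ - 1) ≤ 1)
    (hη : |η - 1 / 2| ≤ t) : keepRate γ C η ∈ Icc (0 : ℝ) 1 := by
  have h1 : C * |η - 1 / 2| ^ (γ - 1) ≤ 1 := le_trans
    (mul_le_mul_of_nonneg_left (Real.rpow_le_rpow (abs_nonneg _) hη (by linarith)) hC.le) ht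
  have h2 : 0 ≤ C * |η - 1 / 2| ^ (γ - 1) := by positivity
  unfold keepRate
  constructor <;> linarith

theorem measurable_workerReg (γ C : ℝ) : Measurable (workerReg γ C) := by
  have : workerReg γ C = fun η => 1 / 2 + C * |η - 1 / 2| ^ (γ - 1) * (η - 1 / 2) :=
    funext fun η => workerReg_eq γ C η
  rw [this]
  fun_prop

/-! ### Uniform laws on a region -/

/-- The uniform law on `Ω`. -/
def regionLaw {d : ℕ} (Ω : Set (Feat d)) : Measure (Feat d) :=
  (volume Ω)⁻¹ • volume.restrict Ω

theorem regionLaw_isProbabilityMeasure {d : ℕ} {Ω : Set (Feat d)} (h0 : volume Ω ≠ 0)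
    (hfin : volume Ω ≠ ∞) : IsProbabilityMeasure (regionLaw Ω) := by
  constructor
  simp [regionLaw, ENNReal.inv_mul_cancel h0 hfin]

/-- Lebesgue measure charges every neighbourhood of an interior point, and the support is closed;
`hint` rules out thin parts of `Ω` that the law would not see. -/
theorem support_regionLaw {d : ℕ} {Ω : Set (Feat d)} (hfin : volume Ω ≠ ∞) (hcl : IsClosed Ω)
    (hint : Ω ⊆ closure (interior Ω)) : (regionLaw Ω).support = Ω := by
  apply Subset.antisymm
  · refine Measure.support_subset_of_isClosed hcl ?_
    refine Measure.ae_smul_measure_le _ ?_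
    exact ae_restrict_mem hcl.measurableSet
  · have hac : volume.restrict Ω ≪ regionLaw Ω :=
      Measure.absolutelyContinuous_smul (ENNReal.inv_ne_zero.2 hfin)
    refine hint.trans (closure_minimal ?_ Measure.isClosed_support)
    refine Subset.trans ?_ hac.support_mono
    refine Subset.trans ?_ Measure.interior_inter_support
    rw [Measure.support_eq_univ, inter_univ]

theorem rnDeriv_regionLaw {d : ℕ} {Ω : Set (Feat d)} (h0 : volume Ω ≠ 0) (hfin : volume Ω ≠ ∞)
    (hΩ : MeasurableSet Ω) :
    ∀ᵐ x ∂(volume.restrict Ω), (regionLaw Ω).rnDeriv volume x = (volume Ω)⁻¹ := by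
  have : IsFiniteMeasure (volume.restrict Ω) := ⟨by simpa using hfin.lt_top⟩
  have h1 := Measure.rnDeriv_smul_left_of_ne_top (volume.restrict Ω) (volume : Measure (Feat d))
    (ENNReal.inv_ne_top.2 h0)
  have h2 := Measure.rnDeriv_restrict_self (volume : Measure (Feat d)) hΩ
  filter_upwards [ae_restrict_of_ae h1, ae_restrict_of_ae h2, ae_restrict_mem hΩ] with x e1 e2 hx
  rw [regionLaw, e1, Pi.smul_apply, e2, indicator_of_mem hx]
  simp

/-- Uniform features on `Ω` together with a regression function within `t₀` of `1/2`. -/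
theorem inClass_regionLaw {d m : ℕ} {p : ClassParams} {γ Cγ : Fin (m + 1) → ℝ} {t₀ : ℝ}
    (hγ0 : γ 0 = 1) (hC0 : Cγ 0 = 1) (hγ : ∀ i, 0 < γ i) (hC : ∀ i, 0 < Cγ i)
    (ht1 : ∀ i, Cγ i * t₀ ^ γ i ≤ 1 / 2) (ht2 : ∀ i, 1 ≤ γ i → Cγ i * t₀ ^ (γ i - 1) ≤ 1)
    {Ω : Set (Feat d)} (h0 : volume Ω ≠ 0) (hfin : volume Ω ≠ ∞) (hcl : IsClosed Ω)
    (hint : Ω ⊆ closure (interior Ω)) {η : Feat d → ℝ} (hη : Measurable η)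
    (hηt : ∀ x, |η x - 1 / 2| ≤ t₀)
    (hholder : ∀ x ∈ Ω, ∀ x' ∈ Ω, |η x - η x'| ≤ p.Cβ * ‖x - x'‖ ^ p.β)
    (hmargin : ∀ t : ℝ, 0 < t →
      regionLaw Ω {x | |η x - 1 / 2| ≤ t} ≤ ENNReal.ofReal (p.Cα * t ^ p.α))
    (hreg : ∀ r : ℝ, 0 < r → r ≤ p.rmu → ∀ x ∈ Ω,
      ENNReal.ofReal p.cmu * volume (Metric.closedBall x r)
        ≤ volume (Ω ∩ Metric.closedBall x r))
    (hlo : ENNReal.ofReal p.muMinus < (volume Ω)⁻¹) (hhi : (volume Ω)⁻¹ < ENNReal.ofReal p.muPlus) :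
    InClass p γ Cγ fun i => obsLaw (regionLaw Ω) fun x => workerReg (γ i) (Cγ i) (η x) := by
  have hprob := regionLaw_isProbabilityMeasure h0 hfin
  have hm : ∀ i, Measurable fun x => workerReg (γ i) (Cγ i) (η x) := fun i =>
    (measurable_workerReg _ _).comp hη
  have h01 : ∀ i x, workerReg (γ i) (Cγ i) (η x) ∈ Icc (0 : ℝ) 1 := fun i x =>
    workerReg_mem_Icc (hγ i) (hC i) (ht1 i) (hηt x)
  have hfst : ∀ i, (obsLaw (regionLaw Ω) fun x => workerReg (γ i) (Cγ i) (η x)).fst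
      = regionLaw Ω := fun i => obsLaw_fst _ (hm i) (h01 i)
  have hsupp := support_regionLaw hfin hcl hint
  refine ⟨fun i => obsLaw_isProbabilityMeasure _ (hm i) (h01 i), ⟨fun i => ?_, fun i => ?_, ?_,
    fun i => ?_⟩, η, ?_, ?_, ?_, fun i => ⟨obsLaw_isRegression _ (hm i) (h01 i), fun h1 x _ =>
      keepRate_mem_Icc h1 (hC i) (ht2 i h1) (hηt x)⟩⟩
  · rw [hfst]
    exact Measure.absolutelyContinuous_of_le_smul
      (Measure.le_iff.2 fun s hs => by
        simp only [regionLaw, Measure.smul_apply]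
        gcongr
        exact Measure.restrict_le_self : regionLaw Ω ≤ (volume Ω)⁻¹ • volume)
  · simp only [hfst]
  · simp only [hfst, hsupp]
    exact hreg
  · simp only [hfst, hsupp]
    filter_upwards [rnDeriv_regionLaw h0 hfin hcl.measurableSet] with x hx
    rw [hx]
    exact ⟨hlo, hhi⟩
  · have e : η = fun x => workerReg (γ 0) (Cγ 0) (η x) := by
      simp only [hγ0, hC0, workerReg_one]
    have := obsLaw_isRegression (regionLaw Ω) (hm 0) (h01 0)
    rwa [← e] at this ⊢
  · simp only [hfst, hsupp]
    exact hholder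
  · simp only [hfst]
    exact hmargin

/-! ### Finite unions of closed balls -/

section Balls

variable {d : ℕ} {ι : Type*} [Fintype ι]

/-- The union of finitely many closed balls. -/
def ballUnion (c : ι → Feat d) (r : ι → ℝ) : Set (Feat d) :=
  ⋃ j, Metric.closedBall (c j) (r j)

/-- The step function with value `1/2 + s j` on the `j`-th ball and `1/2` elsewhere. -/
def stepReg (c : ι → Feat d) (r s : ι → ℝ) (x : Feat d) : ℝ :=
  1 / 2 + ∑ j, (Metric.closedBall (c j) (r j)).indicator (fun _ => s j) x

theorem isClosed_ballUnion (c : ι → Feat d) (r : ι → ℝ) : IsClosed (ballUnion c r) :=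
  isClosed_iUnion_of_finite fun _ => Metric.isClosed_closedBall

theorem ballUnion_subset_closure_interior {ι : Type*} (c : ι → Feat d) {r : ι → ℝ} (hr : ∀ j, 0 < r j) :
    ballUnion c r ⊆ closure (interior (ballUnion c r)) := by
  refine iUnion_subset fun j => ?_
  rw [← closure_ball _ (hr j).ne']
  refine closure_mono (interior_maximal ?_ Metric.isOpen_ball)
  exact Metric.ball_subset_closedBall.trans (subset_iUnion (fun j => Metric.closedBall (c j) (r j)) j)

theorem measurable_stepReg (c : ι → Feat d) (r s : ι → ℝ) : Measurable (stepReg c r s) :=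
  measurable_const.add (Finset.measurable_sum _ fun _ _ =>
    measurable_const.indicator Metric.isClosed_closedBall.measurableSet)

theorem stepReg_of_mem {c : ι → Feat d} {r : ι → ℝ} (s : ι → ℝ)
    (hd : Pairwise fun i j => Disjoint (Metric.closedBall (c i) (r i)) (Metric.closedBall (c j) (r j)))
    {j : ι} {x : Feat d} (hx : x ∈ Metric.closedBall (c j) (r j)) :
    stepReg c r s x = 1 / 2 + s j := by
  rw [stepReg, Finset.sum_eq_single j, indicator_of_mem hx]
  · exact fun i _ hij => indicator_of_notMem (fun hi => disjoint_left.1 (hd hij) hi hx) _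
  · simp

theorem stepReg_of_notMem {c : ι → Feat d} {r : ι → ℝ} (s : ι → ℝ) {x : Feat d}
    (hx : ∀ j, x ∉ Metric.closedBall (c j) (r j)) : stepReg c r s x = 1 / 2 := by
  rw [stepReg, Finset.sum_eq_zero fun j _ => indicator_of_notMem (hx j) _, add_zero]

theorem abs_stepReg_sub_half_le {c : ι → Feat d} {r s : ι → ℝ} {t : ℝ} (ht : 0 ≤ t)
    (hd : Pairwise fun i j => Disjoint (Metric.closedBall (c i) (r i)) (Metric.closedBall (c j) (r j)))
    (hs : ∀ j, |s j| ≤ t) (x : Feat d) : |stepReg c r s x - 1 / 2| ≤ t := by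
  by_cases hx : ∃ j, x ∈ Metric.closedBall (c j) (r j)
  · obtain ⟨j, hj⟩ := hx
    rw [stepReg_of_mem s hd hj, add_sub_cancel_left]
    exact hs j
  · push Not at hx
    rw [stepReg_of_notMem s hx, sub_self, abs_zero]
    exact ht

theorem stepReg_congr_of_notMem {c : ι → Feat d} {r s s' : ι → ℝ} {j : ι}
    (hs : ∀ i, i ≠ j → s' i = s i) {x : Feat d} (hx : x ∉ Metric.closedBall (c j) (r j)) :
    stepReg c r s' x = stepReg c r s x := by
  unfold stepReg
  congr 1
  refine Finset.sum_congr rfl fun i _ => ?_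
  by_cases hij : i = j
  · subst hij
    rw [indicator_of_notMem hx, indicator_of_notMem hx]
  · rw [hs i hij]

end Balls

/-! ### Balls in the feature space -/

theorem volume_closedBall_feat {d : ℕ} (x : Feat d) {r : ℝ} (hr : 0 ≤ r) :
    volume (Metric.closedBall x r) = ENNReal.ofReal (r ^ d) * volume (Metric.ball (0 : Feat d) 1) := by
  rw [Measure.addHaar_closedBall _ _ hr, finrank_euclideanSpace_fin]

theorem norm_le_card_mul {d : ℕ} (x : Feat d) {a : ℝ} (ha : 0 ≤ a) (hx : ∀ i, |x i| ≤ a) :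
    ‖x‖ ≤ d * a := by
  refine (pow_le_pow_iff_left₀ (norm_nonneg _) (by positivity) two_ne_zero).1 ?_
  rw [EuclideanSpace.norm_sq_eq]
  calc ∑ i, ‖x i‖ ^ 2 ≤ ∑ _i : Fin d, a ^ 2 := by
        gcongr with i
        exact hx i
    _ = d * a ^ 2 := by simp
    _ ≤ (d * a) ^ 2 := by
        rw [mul_pow]
        gcongr
        exact_mod_cast Nat.le_self_pow two_ne_zero d

/-- A ball contains a ball of any smaller radius `s` within distance `2 s` of a given point. -/
theorem exists_closedBall_subset {E : Type*} [NormedAddCommGroup E] [NormedSpace ℝ E] {c x : E}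
    {ρ s : ℝ} (hs : 0 < s) (hsρ : s ≤ ρ) (hx : x ∈ Metric.closedBall c ρ) :
    ∃ y, Metric.closedBall y s ⊆ Metric.closedBall c ρ ∩ Metric.closedBall x (2 * s) := by
  have hρ : 0 < ρ := hs.trans_le hsρ
  rw [mem_closedBall_iff_norm] at hx
  -- The point `x` is pulled towards `c` by the fraction `s / ρ`: it moves by at most `s` and ends
  -- within `ρ - s` of `c`.
  refine ⟨c + (1 - s / ρ) • (x - c), subset_inter ?_ ?_⟩
  · refine Metric.closedBall_subset_closedBall' ?_
    have h1 : 0 ≤ 1 - s / ρ := sub_nonneg.2 ((div_le_one hρ).2 hsρ)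
    rw [dist_eq_norm, add_sub_cancel_left, norm_smul, Real.norm_of_nonneg h1]
    calc s + (1 - s / ρ) * ‖x - c‖ ≤ s + (1 - s / ρ) * ρ := by gcongr
      _ = ρ := by field_simp; ring
  · refine Metric.closedBall_subset_closedBall' ?_
    have : c + (1 - s / ρ) • (x - c) - x = (-(s / ρ)) • (x - c) := by module
    rw [dist_eq_norm, this, norm_smul, norm_neg, Real.norm_of_nonneg (by positivity)]
    calc s + s / ρ * ‖x - c‖ ≤ s + s / ρ * ρ := by gcongr
      _ = 2 * s := by field_simp; ring

/-! ### The configuration of balls -/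

/-- A cluster of small balls on a grid of mesh `~ b ^ (-J)`, filling a cube of side `~ b ^ (-K)`,
together with one larger ball at each of the distances `~ b ^ (-k)`, `k ≤ K`, from the cluster. -/
structure Layout (d : ℕ) where
  b : ℕ
  R : ℝ
  J : ℕ
  K : ℕ
  e : Feat d
  dim_pos : 1 ≤ d
  le_b : 16 ≤ b
  R_pos : 0 < R
  K_le : K ≤ J
  norm_e : ‖e‖ = 1

namespace Layout

variable {d : ℕ} (L : Layout d)

/-- The ratio of consecutive scales. -/
def q : ℝ := (L.b : ℝ)⁻¹

/-- The number of grid cells along a side of the cluster. -/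
def side : ℕ := L.b ^ (L.J - L.K)

/-- The ratio of the mesh of the grid to `q ^ J`. -/
def gap : ℝ := L.R * L.q / (2 * d)

/-- The mesh of the grid. -/
def mesh : ℝ := L.gap * L.q ^ L.J

/-- The index set of the balls. -/
abbrev Idx : Type := Fin (L.K + 1) ⊕ (Fin d → Fin L.side)

/-- With radius `R q^k`, the `k`-th large ball lies in the shell `3 R q^k ≤ ‖x‖ ≤ 5 R q^k`; shells
of different index are far apart because `q ≤ 1/16`. The cluster has a corner at the origin. -/
def center : L.Idx → Feat d
  | .inl k => (4 * L.R * L.q ^ (k : ℕ)) • L.e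
  | .inr u => WithLp.toLp 2 fun i => L.mesh * ((u i : ℕ) : ℝ)

def radius : L.Idx → ℝ
  | .inl k => L.R * L.q ^ (k : ℕ)
  | .inr _ => L.mesh / 4

/-- The scale governs both the height `τ * scale ^ β` on a ball and its distance to the other balls.
For a small ball it exceeds the radius by the constant factor `4 / gap`. -/
def scale : L.Idx → ℝ
  | .inl k => L.q ^ (k : ℕ)
  | .inr _ => L.q ^ L.J

abbrev piece (j : L.Idx) : Set (Feat d) := Metric.closedBall (L.center j) (L.radius j)

def region : Set (Feat d) := ballUnion L.center L.radius

/-! ### Size relations between the scales -/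

theorem b_pos : (0 : ℝ) < L.b := by
  have := L.le_b
  positivity

theorem q_pos : 0 < L.q := inv_pos.2 L.b_pos

theorem b_mul_q : L.b * L.q = 1 := mul_inv_cancel₀ L.b_pos.ne'

theorem q_le : L.q ≤ 1 / 16 := by
  have h : (16 : ℝ) ≤ L.b := by exact_mod_cast L.le_b
  rw [q, one_div]
  gcongr

theorem q_lt_one : L.q < 1 := by linarith [L.q_le]

theorem one_le_dim {d : ℕ} (L : Layout d) : (1 : ℝ) ≤ d := by exact_mod_cast L.dim_pos

theorem gap_pos : 0 < L.gap := by
  have := L.one_le_dim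
  have := L.q_pos
  have := L.R_pos
  unfold gap
  positivity

theorem dim_mul_gap : d * L.gap = L.R * L.q / 2 := by
  have := L.one_le_dim
  unfold gap
  field_simp

theorem gap_le : L.gap ≤ L.R * L.q / 2 := by
  rw [← L.dim_mul_gap]
  exact le_mul_of_one_le_left L.gap_pos.le L.one_le_dim

theorem gap_le_R : L.gap ≤ L.R / 32 := by
  have := L.gap_le
  have := mul_le_mul_of_nonneg_left L.q_le L.R_pos.le
  linarith

theorem mesh_pos : 0 < L.mesh := mul_pos L.gap_pos (pow_pos L.q_pos _)

theorem side_mul_q_pow : L.side * L.q ^ L.J = L.q ^ L.K := by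
  have h : L.J = (L.J - L.K) + L.K := (Nat.sub_add_cancel L.K_le).symm
  rw [side]
  push_cast
  conv_lhs => rw [h]
  rw [Nat.add_sub_cancel, pow_add, ← mul_assoc, ← mul_pow, b_mul_q, one_pow, one_mul]

theorem side_mul_mesh : L.side * L.mesh = L.gap * L.q ^ L.K := by
  rw [← side_mul_q_pow, mesh]
  ring

theorem one_le_side : 1 ≤ L.side := Nat.one_le_pow _ _ (by have := L.le_b; omega)

theorem mesh_le : L.mesh ≤ L.gap * L.q ^ L.K := by
  rw [← side_mul_mesh]
  exact le_mul_of_one_le_left L.mesh_pos.le (by exact_mod_cast L.one_le_side)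

theorem q_pow_le {k l : ℕ} (h : k ≤ l) : L.q ^ l ≤ L.q ^ k :=
  pow_le_pow_of_le_one L.q_pos.le L.q_lt_one.le h

theorem radius_pos (j : L.Idx) : 0 < L.radius j := by
  rcases j with k | u
  · exact mul_pos L.R_pos (pow_pos L.q_pos _)
  · exact div_pos L.mesh_pos (by norm_num)

theorem scale_pos (j : L.Idx) : 0 < L.scale j := by
  rcases j with k | u <;> exact pow_pos L.q_pos _

theorem scale_le_one (j : L.Idx) : L.scale j ≤ 1 := by
  rcases j with k | u <;> exact pow_le_one₀ L.q_pos.le L.q_lt_one.le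

/-! ### Separation of the balls and the Hölder condition -/

theorem norm_shell {k : Fin (L.K + 1)} {x : Feat d} (hx : x ∈ L.piece (.inl k)) :
    3 * L.R * L.q ^ (k : ℕ) ≤ ‖x‖ ∧ ‖x‖ ≤ 5 * L.R * L.q ^ (k : ℕ) := by
  have hp : 0 ≤ 4 * L.R * L.q ^ (k : ℕ) :=
    mul_nonneg (mul_nonneg (by norm_num) L.R_pos.le) (pow_pos L.q_pos _).le
  have hc : ‖L.center (.inl k)‖ = 4 * L.R * L.q ^ (k : ℕ) := by
    rw [center, norm_smul, L.norm_e, mul_one, Real.norm_of_nonneg hp]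
  rw [mem_closedBall_iff_norm] at hx
  have h := (abs_norm_sub_norm_le x (L.center (.inl k))).trans hx
  rw [hc, abs_le, radius] at h
  constructor <;> linarith [h.1, h.2]

/-- The factor `1 / (2 d)` in `gap` is chosen for this: centres have norm at most `d * gap * q^K = R
q q^K / 2`, which leaves room for the radius, so the cluster lies well inside the smallest shell. -/
theorem norm_bump {u : Fin d → Fin L.side} {x : Feat d} (hx : x ∈ L.piece (.inr u)) :
    ‖x‖ ≤ L.R * L.q * L.q ^ L.K := by
  have hK : 0 < L.q ^ L.K := pow_pos L.q_pos _
  have hc : ‖L.center (.inr u)‖ ≤ d * (L.gap * L.q ^ L.K) := by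
    refine norm_le_card_mul _ (mul_nonneg L.gap_pos.le hK.le) fun i => ?_
    rw [← side_mul_mesh]
    have hu : ((u i : ℕ) : ℝ) ≤ L.side := by exact_mod_cast (u i).2.le
    have := L.mesh_pos
    rw [show L.center (.inr u) i = L.mesh * ((u i : ℕ) : ℝ) from rfl, abs_of_nonneg (by positivity),
      mul_comm]
    gcongr
  rw [← mul_assoc, L.dim_mul_gap] at hc
  rw [mem_closedBall_iff_norm] at hx
  have h := (abs_norm_sub_norm_le x (L.center (.inr u))).trans hx
  rw [abs_le, show L.radius (.inr u) = L.mesh / 4 from rfl] at h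
  have h1 := L.mesh_le
  have h2 := mul_le_mul_of_nonneg_right L.gap_le hK.le
  have h3 := mul_pos (mul_pos L.R_pos L.q_pos) hK
  nlinarith [h.2]

theorem le_dist_of_norm {k : ℕ} {x y : Feat d} (hx : 3 * L.R * L.q ^ k ≤ ‖x‖)
    (hy : ‖y‖ ≤ L.R * L.q ^ k) : L.gap / 2 * L.q ^ k ≤ dist x y := by
  have h := abs_le.1 (abs_norm_sub_norm_le x y)
  rw [dist_eq_norm]
  have h1 := mul_le_mul_of_nonneg_right L.gap_le_R (pow_pos L.q_pos k).le
  have h2 := mul_pos L.R_pos (pow_pos L.q_pos k)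
  linarith [h.2]

theorem separated_shell {k : Fin (L.K + 1)} {j : L.Idx} {x y : Feat d} (hx : x ∈ L.piece (.inl k))
    (hy : ‖y‖ ≤ L.R * L.q ^ (k : ℕ)) (hj : L.scale j ≤ L.q ^ (k : ℕ)) :
    L.gap / 2 * max (L.scale (.inl k)) (L.scale j) ≤ dist x y := by
  rw [show L.scale (.inl k) = L.q ^ (k : ℕ) from rfl, max_eq_left hj]
  exact L.le_dist_of_norm (L.norm_shell hx).1 hy

theorem norm_shell_le {k l : Fin (L.K + 1)} (h : k < l) {y : Feat d} (hy : y ∈ L.piece (.inl l)) :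
    ‖y‖ ≤ L.R * L.q ^ (k : ℕ) := by
  have h1 := (L.norm_shell hy).2
  have h2 : L.q ^ (l : ℕ) ≤ L.q ^ (k : ℕ) * L.q := by
    rw [← pow_succ]
    exact L.q_pow_le h
  have h3 : L.q ^ (k : ℕ) * L.q ≤ L.q ^ (k : ℕ) * (1 / 16) :=
    mul_le_mul_of_nonneg_left L.q_le (pow_pos L.q_pos _).le
  have h4 := mul_le_mul_of_nonneg_left (h2.trans h3) L.R_pos.le
  have h5 := mul_pos L.R_pos (pow_pos L.q_pos (k : ℕ))
  linarith

theorem norm_bump_le (k : Fin (L.K + 1)) {u : Fin d → Fin L.side} {y : Feat d}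
    (hy : y ∈ L.piece (.inr u)) : ‖y‖ ≤ L.R * L.q ^ (k : ℕ) := by
  have h1 := L.norm_bump hy
  have h2 : L.q ^ L.K ≤ L.q ^ (k : ℕ) := L.q_pow_le (Nat.lt_succ_iff.1 k.2)
  have h3 : L.q * L.q ^ L.K ≤ 1 * L.q ^ (k : ℕ) :=
    mul_le_mul L.q_lt_one.le h2 (pow_pos L.q_pos _).le zero_le_one
  have h4 := mul_le_mul_of_nonneg_left h3 L.R_pos.le
  linarith

/-- A shell is separated from everything of larger index and from the cluster by comparing norms.
Two small balls differ in some grid coordinate; their centres are a mesh apart, and the two radii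
`mesh / 4` leave `mesh / 2`. -/
theorem separated {i j : L.Idx} (hij : i ≠ j) {x y : Feat d} (hx : x ∈ L.piece i)
    (hy : y ∈ L.piece j) : L.gap / 2 * max (L.scale i) (L.scale j) ≤ dist x y := by
  rcases i with k | u <;> rcases j with l | v
  · rcases lt_or_gt_of_ne (fun h => hij (congrArg Sum.inl h) : k ≠ l) with h | h
    · exact L.separated_shell hx (L.norm_shell_le h hy) (L.q_pow_le h.le)
    · rw [max_comm, dist_comm]
      exact L.separated_shell hy (L.norm_shell_le h hx) (L.q_pow_le h.le)
  · exact L.separated_shell hx (L.norm_bump_le k hy)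
      (L.q_pow_le ((Nat.lt_succ_iff.1 k.2).trans L.K_le))
  · rw [max_comm, dist_comm]
    exact L.separated_shell hy (L.norm_bump_le l hx)
      (L.q_pow_le ((Nat.lt_succ_iff.1 l.2).trans L.K_le))
  · have hne : u ≠ v := fun h => hij (congrArg Sum.inr h)
    obtain ⟨i, hi⟩ := Function.ne_iff.1 hne
    have h1 : (1 : ℝ) ≤ |((u i : ℕ) : ℝ) - ((v i : ℕ) : ℝ)| := by
      have : ((u i : ℕ) : ℤ) - ((v i : ℕ) : ℤ) ≠ 0 := by
        have := Fin.val_ne_of_ne hi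
        omega
      exact_mod_cast Int.one_le_abs this
    have h2 : L.mesh ≤ dist (L.center (.inr u)) (L.center (.inr v)) := by
      rw [dist_eq_norm]
      refine le_trans ?_ (PiLp.norm_apply_le (L.center (.inr u) - L.center (.inr v)) i)
      have : (L.center (.inr u) - L.center (.inr v)) i
          = L.mesh * (((u i : ℕ) : ℝ) - ((v i : ℕ) : ℝ)) := by
        rw [mul_sub]; rfl
      rw [this, Real.norm_eq_abs, abs_mul, abs_of_pos L.mesh_pos]
      exact le_mul_of_one_le_right L.mesh_pos.le h1
    have h3 := dist_triangle4 (L.center (.inr u)) x y (L.center (.inr v))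
    rw [Metric.mem_closedBall] at hx hy
    rw [dist_comm] at hx
    have e1 : L.radius (.inr u) = L.mesh / 4 := rfl
    have e2 : L.radius (.inr v) = L.mesh / 4 := rfl
    have e3 : L.gap / 2 * max (L.scale (.inr u)) (L.scale (.inr v)) = L.mesh / 2 := by
      simp only [scale, max_self, mesh]
      ring
    linarith

theorem pairwise_disjoint : Pairwise fun i j => Disjoint (L.piece i) (L.piece j) := by
  intro i j hij
  refine disjoint_left.2 fun x hx hy => ?_
  have h := L.separated hij hx hy
  rw [dist_self] at h
  have h1 := lt_max_of_lt_left (b := L.scale i) (c := L.scale j) (L.scale_pos i)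
  have h2 := mul_pos (half_pos L.gap_pos) h1
  linarith

/-- The function is constant on each ball, and a jump between two balls is at most `2 τ` times the
larger scale to the power `β`, which their separation dominates. Points between the balls do not
belong to the region. -/
theorem holder {s : L.Idx → ℝ} {τ β C : ℝ} (hβ : 0 < β) (hC : 0 < C) (hτ : 0 < τ)
    (hs : ∀ j, |s j| = τ * L.scale j ^ β) (hτC : 2 * τ ≤ C * (L.gap / 2) ^ β) :
    ∀ x ∈ L.region, ∀ x' ∈ L.region,
      |stepReg L.center L.radius s x - stepReg L.center L.radius s x'| ≤ C * ‖x - x'‖ ^ β := by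
  intro x hx y hy
  obtain ⟨i, hi⟩ := mem_iUnion.1 hx
  obtain ⟨j, hj⟩ := mem_iUnion.1 hy
  rw [stepReg_of_mem s L.pairwise_disjoint hi, stepReg_of_mem s L.pairwise_disjoint hj]
  by_cases hij : i = j
  · subst hij
    rw [sub_self, abs_zero]
    positivity
  · have hsep := L.separated hij hi hj
    have hg := half_pos L.gap_pos
    have hm : ∀ i', i' = i ∨ i' = j → |s i'| ≤ τ * max (L.scale i) (L.scale j) ^ β := by
      rintro i' (rfl | rfl) <;> rw [hs] <;>
        refine mul_le_mul_of_nonneg_left (Real.rpow_le_rpow (L.scale_pos _).le ?_ hβ.le) hτ.le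
      · exact le_max_left _ _
      · exact le_max_right _ _
    have hmax : 0 ≤ max (L.scale i) (L.scale j) := (L.scale_pos i).le.trans (le_max_left _ _)
    calc |1 / 2 + s i - (1 / 2 + s j)| = |s i - s j| := by congr 1; ring
      _ ≤ |s i| + |s j| := abs_sub _ _
      _ ≤ 2 * τ * max (L.scale i) (L.scale j) ^ β := by
          linarith [hm i (Or.inl rfl), hm j (Or.inr rfl)]
      _ ≤ C * (L.gap / 2) ^ β * max (L.scale i) (L.scale j) ^ β := by gcongr
      _ = C * (L.gap / 2 * max (L.scale i) (L.scale j)) ^ β := by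
          rw [Real.mul_rpow hg.le hmax, mul_assoc]
      _ ≤ C * ‖x - y‖ ^ β := by
          rw [← dist_eq_norm]
          gcongr

end Layout

namespace Layout

variable {d : ℕ} (L : Layout d)

theorem piece_subset_region (j : L.Idx) : L.piece j ⊆ L.region :=
  subset_iUnion (fun j => Metric.closedBall (L.center j) (L.radius j)) j

theorem norm_le_of_mem_shell_or_bump {t a : ℝ} (ht : ∀ k : Fin (L.K + 1), L.q ^ (k : ℕ) ≤ t →
    5 * L.R * L.q ^ (k : ℕ) ≤ a) (ht' : L.q ^ L.J ≤ t → L.R * L.q * L.q ^ L.K ≤ a) {j : L.Idx}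
    (hj : L.scale j ≤ t) {x : Feat d} (hx : x ∈ L.piece j) : ‖x‖ ≤ a := by
  rcases j with k | u
  · exact (L.norm_shell hx).2.trans (ht k hj)
  · exact (L.norm_bump hx).trans (ht' hj)

/-! ### Volume -/

theorem le_volume_region :
    ENNReal.ofReal (L.R ^ d) * volume (Metric.ball (0 : Feat d) 1) ≤ volume L.region := by
  have h := L.piece_subset_region (.inl 0)
  rw [← volume_closedBall_feat (L.center (.inl 0)) L.R_pos.le]
  have e : L.radius (.inl 0) = L.R := by simp [radius]
  rw [piece, e] at h
  exact measure_mono h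

/-- Everything but the largest ball fits in a ball of radius `5 R q`. For small `q` the density is
thus nearly that of a single ball of radius `R`. -/
theorem volume_region_le : volume L.region ≤ ENNReal.ofReal (L.R ^ d + (5 * L.R * L.q) ^ d)
    * volume (Metric.ball (0 : Feat d) 1) := by
  have hR := L.R_pos
  have hq := L.q_pos
  have hsub : L.region ⊆ Metric.closedBall (L.center (.inl 0)) L.R ∪
      Metric.closedBall 0 (5 * L.R * L.q) := by
    refine iUnion_subset fun j x hx => ?_
    rcases j with k | u
    · by_cases hk : k = 0
      · subst hk
        left
        simpa [radius] using hx
      · right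
        rw [mem_closedBall_zero_iff]
        refine (L.norm_shell hx).2.trans ?_
        have h1 : 1 ≤ (k : ℕ) := Nat.one_le_iff_ne_zero.2 fun h => hk (Fin.ext h)
        have h2 := L.q_pow_le h1
        rw [pow_one] at h2
        gcongr
    · right
      rw [mem_closedBall_zero_iff]
      refine (L.norm_bump hx).trans ?_
      have h2 : L.q ^ L.K ≤ 1 := pow_le_one₀ hq.le L.q_lt_one.le
      have h3 := mul_pos hR hq
      nlinarith
  refine (measure_mono hsub).trans ((measure_union_le _ _).trans (le_of_eq ?_))
  rw [volume_closedBall_feat _ hR.le, volume_closedBall_feat _ (by positivity), ← add_mul,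
    ENNReal.ofReal_add (by positivity) (by positivity)]

theorem volume_unitBall_pos : volume (Metric.ball (0 : Feat d) 1) ≠ 0 :=
  (Metric.measure_ball_pos volume _ one_pos).ne'

theorem volume_unitBall_ne_top : volume (Metric.ball (0 : Feat d) 1) ≠ ∞ :=
  measure_ball_lt_top.ne

theorem volume_region_ne_zero : volume L.region ≠ 0 := by
  have h := L.le_volume_region
  have h1 : ENNReal.ofReal (L.R ^ d) ≠ 0 := (ENNReal.ofReal_pos.2 (pow_pos L.R_pos d)).ne'
  exact fun h0 => mul_ne_zero h1 volume_unitBall_pos (le_zero_iff.1 (h0 ▸ h))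

theorem volume_region_ne_top : volume L.region ≠ ∞ :=
  ne_top_of_le_ne_top (ENNReal.mul_ne_top ENNReal.ofReal_ne_top volume_unitBall_ne_top)
    L.volume_region_le

/-! ### Margin -/

theorem regionLaw_le_of_inter_subset {a : ℝ} (ha : 0 ≤ a) {s : Set (Feat d)}
    {c : Feat d} (hs : s ∩ L.region ⊆ Metric.closedBall c (L.R * a)) :
    regionLaw L.region s ≤ ENNReal.ofReal (a ^ d) := by
  have hR := L.R_pos
  have hmeas : MeasurableSet L.region := (isClosed_ballUnion _ _).measurableSet
  rw [regionLaw, Measure.smul_apply, smul_eq_mul, Measure.restrict_apply' hmeas]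
  refine ENNReal.inv_mul_le_iff L.volume_region_ne_zero L.volume_region_ne_top |>.2 ?_
  calc volume (s ∩ L.region) ≤ volume (Metric.closedBall c (L.R * a)) := measure_mono hs
    _ = ENNReal.ofReal (L.R ^ d) * volume (Metric.ball (0 : Feat d) 1) * ENNReal.ofReal (a ^ d) := by
        rw [volume_closedBall_feat _ (by positivity), mul_pow, ENNReal.ofReal_mul (by positivity)]
        ring
    _ ≤ volume L.region * ENNReal.ofReal (a ^ d) := by
        gcongr
        exact L.le_volume_region

/-- With `z = (t / τ)^(1/β) < 1`, only balls of scale at most `z` count. Such shells lie within `5 R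
z ≤ 5 R z^(αβ/d)` of the origin because `αβ ≤ d`, and the cluster, if it counts, within `R b
z^(αβ/d)` by `hK`. A ball of radius `5 b R z^(αβ/d)` has mass at most `(5b)^d z^(αβ)`. -/
theorem margin {s : L.Idx → ℝ} {τ α β : ℝ} (hα : 0 ≤ α) (hβ : 0 < β) (hαβ : α * β ≤ d)
    (hτ : 0 < τ) (hs : ∀ j, |s j| = τ * L.scale j ^ β)
    (hK : L.q ^ L.K ≤ L.b * (L.q ^ L.J) ^ (α * β / d)) {t : ℝ} (ht : 0 < t) :
    regionLaw L.region {x | |stepReg L.center L.radius s x - 1 / 2| ≤ t}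
      ≤ ENNReal.ofReal ((5 * L.b) ^ d * τ⁻¹ ^ α * t ^ α) := by
  have hprob := regionLaw_isProbabilityMeasure L.volume_region_ne_zero L.volume_region_ne_top
  have hd := L.one_le_dim
  have hb := L.b_pos
  have hR := L.R_pos
  have hq := L.q_pos
  have hb1 : (16 : ℝ) ≤ L.b := by exact_mod_cast L.le_b
  rw [mul_assoc, ← Real.mul_rpow (inv_pos.2 hτ).le ht.le]
  set y := τ⁻¹ * t with hy
  have hy0 : 0 < y := by positivity
  rcases le_or_gt 1 y with h1 | h1
  · refine prob_le_one.trans ?_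
    rw [← ENNReal.ofReal_one]
    refine ENNReal.ofReal_le_ofReal ?_
    have h2 : 1 ≤ y ^ α := Real.one_le_rpow h1 hα
    have h3 : (1 : ℝ) ≤ (5 * L.b) ^ d := one_le_pow₀ (by linarith)
    nlinarith
  · set z := y ^ (1 / β) with hz
    have hz0 : 0 < z := Real.rpow_pos_of_pos hy0 _
    have hz1 : z ≤ 1 := Real.rpow_le_one hy0.le h1.le (by positivity)
    have hzy : z ^ β = y := by rw [hz, ← Real.rpow_mul hy0.le, one_div_mul_cancel hβ.ne',
      Real.rpow_one]
    have hexp : α * β / d ≤ 1 := (div_le_one (by linarith)).2 hαβ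
    have hexp0 : 0 ≤ α * β / d := by positivity
    have hzz : z ≤ z ^ (α * β / d) := by
      simpa using Real.rpow_le_rpow_of_exponent_ge hz0 hz1 hexp
    have e : (5 * L.b * z ^ (α * β / d)) ^ d = (5 * L.b) ^ d * y ^ α := by
      rw [mul_pow, ← Real.rpow_mul_natCast hz0.le, div_mul_cancel₀ _ (by linarith), mul_comm α,
        Real.rpow_mul hz0.le, hzy]
    rw [← e]
    refine L.regionLaw_le_of_inter_subset (c := 0) (by positivity) fun x hx => ?_
    obtain ⟨hxt, hxr⟩ := hx
    obtain ⟨j, hj⟩ := mem_iUnion.1 hxr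
    have hxt : |stepReg L.center L.radius s x - 1 / 2| ≤ t := hxt
    rw [stepReg_of_mem s L.pairwise_disjoint hj, add_sub_cancel_left, hs] at hxt
    have hjz : L.scale j ≤ z := by
      have : L.scale j ^ β ≤ z ^ β := by
        rw [hzy, hy, inv_mul_eq_div, le_div_iff₀ hτ]
        linarith
      exact (Real.rpow_le_rpow_iff (L.scale_pos j).le hz0.le hβ).1 this
    rw [mem_closedBall_zero_iff]
    refine L.norm_le_of_mem_shell_or_bump (fun k hk => ?_) (fun hJ => ?_) hjz hj
    · have h2 := hk.trans hzz
      have h3 : L.q ^ (k : ℕ) ≤ L.b * z ^ (α * β / d) :=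
        h2.trans (le_mul_of_one_le_left (by positivity) (by linarith))
      nlinarith
    · have h2 : L.q ^ L.K ≤ L.b * z ^ (α * β / d) := hK.trans (by gcongr)
      have h3 : 0 < L.q ^ L.K := pow_pos hq _
      have h4 : L.R * L.q * L.q ^ L.K ≤ L.R * 1 * L.q ^ L.K := by
        gcongr
        exact L.q_lt_one.le
      have h5 := mul_le_mul_of_nonneg_left h2 hR.le
      have h6 := mul_pos hR h3
      linarith

/-! ### Regularity of the region -/

theorem regular_of_le_volume {s : ℝ} {x : Feat d} {r : ℝ} (hr : 0 ≤ r)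
    (h : L.q / (80 * d) * r ≤ s) {A : Set (Feat d)}
    (hA : ENNReal.ofReal (s ^ d) * volume (Metric.ball (0 : Feat d) 1) ≤ volume A) :
    ENNReal.ofReal ((L.q / (80 * d)) ^ d) * volume (Metric.closedBall x r) ≤ volume A := by
  have hq := L.q_pos
  rw [volume_closedBall_feat _ hr, ← mul_assoc, ← ENNReal.ofReal_mul (by positivity), ← mul_pow]
  refine le_trans ?_ hA
  gcongr

theorem const_mul_le {a : ℝ} (ha : 0 ≤ a) : L.q / (80 * d) * a ≤ L.q / 80 * a := by
  have hd := L.one_le_dim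
  have hq := L.q_pos
  gcongr
  linarith

theorem regular_near {j : L.Idx} {x : Feat d} (hx : x ∈ L.piece j) {r : ℝ} (hr : 0 < r)
    (hrj : r ≤ 10 * L.radius j) :
    ENNReal.ofReal ((L.q / (80 * d)) ^ d) * volume (Metric.closedBall x r)
      ≤ volume (L.region ∩ Metric.closedBall x r) := by
  obtain ⟨y, hy⟩ := exists_closedBall_subset (s := r / 10) (by positivity) (by linarith) hx
  have h1 := L.const_mul_le hr.le
  have h2 := mul_le_mul_of_nonneg_right L.q_le hr.le
  refine L.regular_of_le_volume hr.le (s := r / 10) (by linarith) ?_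
  rw [← volume_closedBall_feat y (by positivity)]
  refine measure_mono (hy.trans (inter_subset_inter (L.piece_subset_region j) ?_))
  exact Metric.closedBall_subset_closedBall (by linarith)

/-- For `q^(n+1) < r / (10 R) ≤ q^n`, the shell ball of index `n + 1 ≤ k` and the point `x` both lie
within `5 R q^(n+1)` of the origin, so that ball is inside the ball of radius `r` about `x`; its
radius is at least `q r / 10`. -/
theorem regular_far {k : ℕ} (hk : k ≤ L.K) {x : Feat d} (hx : ‖x‖ ≤ 5 * L.R * L.q ^ k) {r : ℝ}
    (hkr : 10 * L.R * L.q ^ k < r) (hr : r ≤ L.R) :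
    ENNReal.ofReal ((L.q / (80 * d)) ^ d) * volume (Metric.closedBall x r)
      ≤ volume (L.region ∩ Metric.closedBall x r) := by
  have hR := L.R_pos
  have hq := L.q_pos
  have hqk := pow_pos hq k
  have hr0 : 0 < r := lt_trans (by positivity) hkr
  obtain ⟨n, hn1, hn2⟩ := exists_nat_pow_near_of_lt_one (x := r / (10 * L.R)) (by positivity)
    ((div_le_one (by positivity)).2 (by linarith)) hq L.q_lt_one
  have hnk : n + 1 ≤ k := by
    have h1 : L.q ^ k < L.q ^ n := by
      refine lt_of_lt_of_le ?_ hn2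
      rw [lt_div_iff₀ (by positivity)]
      linarith
    exact Nat.succ_le_of_lt ((pow_lt_pow_iff_right_of_lt_one₀ hq L.q_lt_one).1 h1)
  rw [lt_div_iff₀ (by positivity)] at hn1
  rw [div_le_iff₀ (by positivity)] at hn2
  have hlt : n + 1 < L.K + 1 := by omega
  have hpq : L.q ^ (n + 1) = L.q * L.q ^ n := pow_succ' _ _
  refine L.regular_of_le_volume hr0.le (s := L.R * L.q ^ (n + 1)) ?_ ?_
  · have h1 := L.const_mul_le hr0.le
    have h2 := mul_le_mul_of_nonneg_left hn2 hq.le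
    have h3 : 0 < L.R * (L.q * L.q ^ n) := by positivity
    rw [hpq]
    linarith
  · rw [← volume_closedBall_feat (L.center (.inl ⟨n + 1, hlt⟩)) (by positivity)]
    refine measure_mono (subset_inter (L.piece_subset_region (.inl ⟨n + 1, hlt⟩)) fun y hy => ?_)
    have h1 := (L.norm_shell (k := ⟨n + 1, hlt⟩) hy).2
    have h2 : L.q ^ k ≤ L.q ^ (n + 1) := L.q_pow_le hnk
    have h3 := mul_le_mul_of_nonneg_left h2 hR.le
    rw [mem_closedBall_iff_norm]
    have h4 := norm_sub_le y x
    simp only at h1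
    linarith

theorem succ_le_card_neighbours {M T : ℕ} (hT : T + 1 ≤ M) (a : Fin M) :
    T + 1 ≤ (Finset.univ.filter fun v : Fin M => (v : ℕ) ≤ a + T ∧ (a : ℕ) ≤ v + T).card := by
  -- A block of `T + 1` consecutive indices containing `a`, shifted back where it would leave the
  -- grid.
  set lo := min (a : ℕ) (M - 1 - T) with hlo
  have ha := a.2
  calc T + 1 = (Finset.univ : Finset (Fin (T + 1))).card := by simp
    _ ≤ _ := Finset.card_le_card_of_injOn
      (fun t => (⟨lo + t, by have := t.2; omega⟩ : Fin M)) (fun t _ => by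
        have := t.2
        simp only [Finset.coe_filter, Finset.mem_univ, true_and, mem_ofPred_eq]
        omega)
      (fun t _ t' _ h => by
        have := congrArg Fin.val h
        simp only at this
        exact Fin.ext (by omega))

/-- Small balls within `T` grid steps of `u` in each coordinate lie inside the ball of radius `r`,
and there are at least `(T + 1)^d` of them, even at the edge of the grid. `T` is of order `r / (d *
mesh)`, capped by the size of the grid. -/
theorem regular_cluster {u : Fin d → Fin L.side} {x : Feat d} (hx : x ∈ L.piece (.inr u)) {r : ℝ}
    (hr : L.mesh ≤ r) (hrK : r ≤ 10 * L.R * L.q ^ L.K) :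
    ENNReal.ofReal ((L.q / (80 * d)) ^ d) * volume (Metric.closedBall x r)
      ≤ volume (L.region ∩ Metric.closedBall x r) := by
  have hR := L.R_pos
  have hq := L.q_pos
  have hm := L.mesh_pos
  have hr0 : 0 < r := hm.trans_le hr
  have hd := L.one_le_dim
  have hd0 : (0 : ℝ) < d := by linarith
  have hside := L.one_le_side
  have hquot : 0 ≤ (r / L.mesh - 1 / 2) / d := by
    have : 1 ≤ r / L.mesh := (one_le_div hm).2 hr
    exact div_nonneg (by linarith) hd0.le
  set F := ⌊(r / L.mesh - 1 / 2) / d⌋₊ with hF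
  set T := min (L.side - 1) F with hT
  have hT1 : T + 1 ≤ L.side := by omega
  have hTr : d * (L.mesh * T) ≤ r - L.mesh / 2 := by
    have h1 : (T : ℝ) ≤ (r / L.mesh - 1 / 2) / d :=
      le_trans (by exact_mod_cast min_le_right _ _) (Nat.floor_le hquot)
    rw [le_div_iff₀ hd0] at h1
    have h2 := mul_le_mul_of_nonneg_right h1 hm.le
    rw [sub_mul, div_mul_cancel₀ _ hm.ne'] at h2
    linarith
  have hTs : L.q / (80 * d) * r ≤ (T + 1) * (L.mesh / 4) := by
    rcases min_choice (L.side - 1) F with h | h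
    · have e : (T : ℝ) + 1 = L.side := by
        rw [← hT] at h
        have : T + 1 = L.side := by omega
        exact_mod_cast this
      rw [e, ← mul_div_assoc, L.side_mul_mesh, gap]
      -- When the whole cluster is used, `r = 10 R q^K` gives equality; this case fixes the constant
      -- `q / (80 d)`.
      have h1 := mul_le_mul_of_nonneg_left hrK (show 0 ≤ L.q / (80 * d) by positivity)
      refine h1.trans (le_of_eq ?_)
      field_simp
      ring
    · have h1 : (r / L.mesh - 1 / 2) / d < T + 1 := by
        rw [hT, h]
        exact Nat.lt_floor_add_one _
      rw [div_lt_iff₀ hd0] at h1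
      have h2 := mul_lt_mul_of_pos_right h1 hm
      rw [sub_mul, div_mul_cancel₀ _ hm.ne'] at h2
      have h3 : r / 2 ≤ (T + 1) * d * L.mesh := by linarith
      rw [div_mul_eq_mul_div, div_le_iff₀ (by positivity)]
      have h4 := mul_le_mul_of_nonneg_right L.q_le hr0.le
      linarith
  set N : Finset (Fin d → Fin L.side) := Fintype.piFinset fun i =>
    Finset.univ.filter fun v : Fin L.side => (v : ℕ) ≤ u i + T ∧ (u i : ℕ) ≤ v + T with hN
  have hcard : (T + 1) ^ d ≤ N.card := by
    rw [hN, Fintype.card_piFinset]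
    calc (T + 1) ^ d = ∏ _i : Fin d, (T + 1) := by simp
      _ ≤ _ := Finset.prod_le_prod' fun i _ => succ_le_card_neighbours hT1 (u i)
  have hsub : ∀ v ∈ N, L.piece (.inr v) ⊆ L.region ∩ Metric.closedBall x r := by
    intro v hv
    refine subset_inter (L.piece_subset_region _) fun y hy => ?_
    have hcc : dist (L.center (.inr v)) (L.center (.inr u)) ≤ d * (L.mesh * T) := by
      rw [dist_eq_norm]
      refine norm_le_card_mul _ (by positivity) fun i => ?_
      have hvi := Fintype.mem_piFinset.1 hv i
      simp only [Finset.mem_filter, Finset.mem_univ, true_and] at hvi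
      have : (L.center (.inr v) - L.center (.inr u)) i
          = L.mesh * (((v i : ℕ) : ℝ) - ((u i : ℕ) : ℝ)) := by
        rw [mul_sub]; rfl
      rw [this, abs_mul, abs_of_pos hm]
      gcongr
      have c1 : ((v i : ℕ) : ℝ) ≤ (u i : ℕ) + T := by exact_mod_cast hvi.1
      have c2 : ((u i : ℕ) : ℝ) ≤ (v i : ℕ) + T := by exact_mod_cast hvi.2
      rw [abs_le]
      constructor <;> linarith
    have h3 := dist_triangle4 y (L.center (.inr v)) (L.center (.inr u)) x
    rw [Metric.mem_closedBall] at hx hy ⊢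
    rw [dist_comm] at hx
    have e1 : L.radius (.inr u) = L.mesh / 4 := rfl
    have e2 : L.radius (.inr v) = L.mesh / 4 := rfl
    linarith
  refine L.regular_of_le_volume hr0.le hTs ?_
  calc ENNReal.ofReal (((T + 1) * (L.mesh / 4)) ^ d) * volume (Metric.ball (0 : Feat d) 1)
      = ((T + 1) ^ d : ℕ) * (ENNReal.ofReal ((L.mesh / 4) ^ d)
          * volume (Metric.ball (0 : Feat d) 1)) := by
        rw [mul_pow, ENNReal.ofReal_mul (by positivity), ← mul_assoc]
        congr 2
        rw [← ENNReal.ofReal_natCast]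
        push_cast
        rfl
    _ ≤ N.card * (ENNReal.ofReal ((L.mesh / 4) ^ d) * volume (Metric.ball (0 : Feat d) 1)) := by
        gcongr
    _ = ∑ v ∈ N, volume (L.piece (.inr v)) := by
        have hv : ∀ v ∈ N, volume (L.piece (.inr v)) = ENNReal.ofReal ((L.mesh / 4) ^ d)
            * volume (Metric.ball (0 : Feat d) 1) := fun v _ =>
          volume_closedBall_feat (L.center (.inr v)) (L.radius_pos (.inr v)).le
        rw [Finset.sum_congr rfl hv, Finset.sum_const, nsmul_eq_mul]
    _ = volume (⋃ v ∈ N, L.piece (.inr v)) :=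
        (measure_biUnion_finset (fun v _ v' _ h => L.pairwise_disjoint
          (fun h' => h (Sum.inr_injective h'))) fun v _ =>
            Metric.isClosed_closedBall.measurableSet).symm
    _ ≤ volume (L.region ∩ Metric.closedBall x r) := measure_mono (iUnion₂_subset hsub)

theorem regular {x : Feat d} (hx : x ∈ L.region) {r : ℝ} (hr : 0 < r) (hrR : r ≤ L.R) :
    ENNReal.ofReal ((L.q / (80 * d)) ^ d) * volume (Metric.closedBall x r)
      ≤ volume (L.region ∩ Metric.closedBall x r) := by
  obtain ⟨j, hj⟩ := mem_iUnion.1 hx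
  rcases le_or_gt r (10 * L.radius j) with h | h
  · exact L.regular_near hj hr h
  · rcases j with k | u
    · refine L.regular_far (Nat.lt_succ_iff.1 k.2) (L.norm_shell hj).2 ?_ hrR
      rw [mul_assoc]
      exact h
    · have hm := L.mesh_pos
      have e : L.radius (.inr u) = L.mesh / 4 := rfl
      rcases le_or_gt r (10 * L.R * L.q ^ L.K) with h' | h'
      · exact L.regular_cluster hj (by linarith) h'
      · refine L.regular_far le_rfl ((L.norm_bump_le (Fin.last L.K) hj).trans ?_) h' hrR
        have := mul_pos L.R_pos (pow_pos L.q_pos L.K)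
        rw [Fin.val_last]
        linarith

end Layout

namespace Layout

variable {d : ℕ} (L : Layout d)

/-! ### The family of regression functions -/

/-- Height of the regression function above `1/2`, with sign `σ u` on the `u`-th small ball. -/
def height (τ β : ℝ) (σ : (Fin d → Fin L.side) → Bool) : L.Idx → ℝ
  | .inl k => τ * (L.q ^ (k : ℕ)) ^ β
  | .inr u => if σ u then τ * (L.q ^ L.J) ^ β else -(τ * (L.q ^ L.J) ^ β)

theorem abs_height {τ : ℝ} (hτ : 0 < τ) (β : ℝ) (σ : (Fin d → Fin L.side) → Bool) (j : L.Idx) :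
    |L.height τ β σ j| = τ * L.scale j ^ β := by
  have h : 0 ≤ τ * L.scale j ^ β := mul_nonneg hτ.le (Real.rpow_nonneg (L.scale_pos j).le _)
  rcases j with k | u
  · exact abs_of_nonneg h
  · cases hu : σ u
    · simp only [height, hu, Bool.false_eq_true, if_false, abs_neg]
      exact abs_of_nonneg h
    · simp only [height, hu, if_true]
      exact abs_of_nonneg h

theorem abs_height_le {τ β : ℝ} (hτ : 0 < τ) (hβ : 0 < β) (σ : (Fin d → Fin L.side) → Bool)
    (j : L.Idx) : |L.height τ β σ j| ≤ τ := by
  rw [L.abs_height hτ]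
  exact mul_le_of_le_one_right hτ.le
    (Real.rpow_le_one (L.scale_pos j).le (L.scale_le_one j) hβ.le)

theorem height_update (τ β : ℝ) (σ : (Fin d → Fin L.side) → Bool) (u : Fin d → Fin L.side)
    (s : Bool) {j : L.Idx} (hj : j ≠ .inr u) :
    L.height τ β (Function.update σ u s) j = L.height τ β σ j := by
  classical
  rcases j with k | v
  · rfl
  · have : v ≠ u := fun h => hj (congrArg _ h)
    simp [height, this]

/-- The probability of a small ball. -/
def bumpMass : ℝ≥0∞ :=
  (volume L.region)⁻¹ * (ENNReal.ofReal ((L.mesh / 4) ^ d) * volume (Metric.ball (0 : Feat d) 1))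

theorem regionLaw_bump (u : Fin d → Fin L.side) :
    regionLaw L.region (L.piece (.inr u)) = L.bumpMass := by
  rw [regionLaw, Measure.smul_apply, smul_eq_mul,
    Measure.restrict_apply Metric.isClosed_closedBall.measurableSet,
    inter_eq_self_of_subset_left (L.piece_subset_region _),
    volume_closedBall_feat _ (L.radius_pos _).le]
  rfl

theorem bumpMass_le : L.bumpMass ≤ ENNReal.ofReal ((L.q ^ L.J) ^ d) := by
  have hside := L.one_le_side
  have hq := pow_pos L.q_pos L.J
  rw [← L.regionLaw_bump fun _ => ⟨0, hside⟩]
  refine L.regionLaw_le_of_inter_subset (c := L.center (.inr fun _ => ⟨0, hside⟩)) hq.le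
    (inter_subset_left.trans (Metric.closedBall_subset_closedBall ?_))
  have h := mul_le_mul_of_nonneg_right L.gap_le_R hq.le
  have := mul_pos L.R_pos hq
  simp only [radius, mesh]
  linarith

theorem le_bumpMass :
    ENNReal.ofReal ((L.q / (8 * d)) ^ d * (L.q ^ L.J) ^ d / 2) ≤ L.bumpMass := by
  have hR := L.R_pos
  have hq := L.q_pos
  have hd := L.one_le_dim
  have hvol : volume L.region ≤ ENNReal.ofReal (2 * L.R ^ d)
      * volume (Metric.ball (0 : Feat d) 1) := by
    refine L.volume_region_le.trans ?_
    gcongr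
    have : (5 * L.R * L.q) ^ d ≤ L.R ^ d := by
      gcongr
      nlinarith [L.q_le]
    linarith
  rw [bumpMass, mul_comm (volume L.region)⁻¹, ← div_eq_mul_inv,
    ENNReal.le_div_iff_mul_le (Or.inl L.volume_region_ne_zero) (Or.inl L.volume_region_ne_top)]
  refine (mul_le_mul_right hvol _).trans (le_of_eq ?_)
  rw [← mul_assoc, ← ENNReal.ofReal_mul (by positivity)]
  congr 2
  have e : L.mesh / 4 = L.q / (8 * d) * L.q ^ L.J * L.R := by
    rw [mesh, gap]
    field_simp
    norm_num
  rw [e, mul_pow, mul_pow]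
  ring

/-- `hK` keeps the cluster small enough for the margin condition, `hK'` keeps its mass at least of
order `s^(αβ)` for `s = q^J`, and `hinfo` keeps the signs undetectable. -/
theorem minimaxRisk_ge {m : ℕ} (n : Fin (m + 1) → ℕ) {p : ClassParams} {γ Cγ : Fin (m + 1) → ℝ}
    {t₀ τ : ℝ} (hτ : 0 < τ) (hτt : τ ≤ t₀) (hα : 0 ≤ p.α) (hβ : 0 < p.β) (hαβ : p.α * p.β ≤ d)
    (hCβ : 0 < p.Cβ) (hτC : 2 * τ ≤ p.Cβ * (L.gap / 2) ^ p.β)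
    (hCα : (5 * L.b) ^ d * τ⁻¹ ^ p.α ≤ p.Cα) (hcmu : p.cmu ≤ (L.q / (80 * d)) ^ d)
    (hrmu : p.rmu ≤ L.R)
    (hlo : ENNReal.ofReal p.muMinus < (volume L.region)⁻¹)
    (hhi : (volume L.region)⁻¹ < ENNReal.ofReal p.muPlus)
    (hγ0 : γ 0 = 1) (hC0 : Cγ 0 = 1) (hγ : ∀ i, 0 < γ i) (hC : ∀ i, 0 < Cγ i)
    (ht1 : ∀ i, Cγ i * t₀ ^ γ i ≤ 1 / 2) (ht2 : ∀ i, 1 ≤ γ i → Cγ i * t₀ ^ (γ i - 1) ≤ 1)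
    (hK : L.q ^ L.K ≤ L.b * (L.q ^ L.J) ^ (p.α * p.β / d))
    (hK' : (L.q ^ L.J) ^ (p.α * p.β) ≤ (L.q ^ L.K) ^ d)
    (hinfo : ∑ i, (n i : ℝ) * (L.q ^ L.J) ^ (2 * γ i * p.β + d) ≤ 1 / 2) :
    ENNReal.ofReal (τ / 16 * (L.q / (8 * d)) ^ d * (L.q ^ L.J) ^ (p.β * (1 + p.α)))
      ≤ minimaxRisk d n p γ Cγ := by
  classical
  have hq := L.q_pos
  have hqJ := pow_pos hq L.J
  have hqK := pow_pos hq L.K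
  have hd := L.one_le_dim
  have ht0 : 0 < t₀ := hτ.trans_le hτt
  have hprob := regionLaw_isProbabilityMeasure L.volume_region_ne_zero L.volume_region_ne_top
  set h := τ * (L.q ^ L.J) ^ p.β with hh
  have hh0 : 0 < h := by positivity
  set g : ((Fin d → Fin L.side) → Bool) → Feat d → ℝ := fun σ =>
    stepReg L.center L.radius (L.height τ p.β σ) with hg
  have hgt : ∀ σ x, |g σ x - 1 / 2| ≤ t₀ := fun σ =>
    abs_stepReg_sub_half_le ht0.le L.pairwise_disjoint fun j => (L.abs_height_le hτ hβ σ j).trans hτt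
  have hgm : ∀ σ, Measurable (g σ) := fun σ => measurable_stepReg _ _ _
  set η : ((Fin d → Fin L.side) → Bool) → Fin (m + 1) → Feat d → ℝ := fun σ i x =>
    workerReg (γ i) (Cγ i) (g σ x) with hη
  have hclass : ∀ σ, InClass p γ Cγ fun i => obsLaw (regionLaw L.region) (η σ i) := fun σ =>
    inClass_regionLaw hγ0 hC0 hγ hC ht1 ht2 L.volume_region_ne_zero L.volume_region_ne_top
      (isClosed_ballUnion _ _) (ballUnion_subset_closure_interior _ L.radius_pos) (hgm σ) (hgt σ)
      (L.holder hβ hCβ hτ (L.abs_height hτ p.β σ) hτC)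
      (fun t ht => (L.margin hα hβ hαβ hτ (L.abs_height hτ p.β σ) hK ht).trans
        (ENNReal.ofReal_le_ofReal (by gcongr)))
      (fun r hr hr' x hx => le_trans (by gcongr) (L.regular hx hr (hr'.trans hrmu))) hlo hhi
  set θ : Fin (m + 1) → ℝ := fun i => Cγ i * h ^ γ i with hθ
  have hθ0 : θ 0 = h := by simp [hθ, hγ0, hC0]
  -- As `τ ≤ t₀`, the bound `Cγ i * t₀ ^ γ i ≤ 1/2` absorbs all constants that depend on the source.
  have hθle : ∀ i, 4 * θ i ^ 2 ≤ (L.q ^ L.J) ^ (2 * γ i * p.β) := by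
    intro i
    have h1 : θ i ≤ 1 / 2 * (L.q ^ L.J) ^ (γ i * p.β) := by
      calc θ i = Cγ i * τ ^ γ i * (L.q ^ L.J) ^ (γ i * p.β) := by
            simp only [hθ, hh]
            rw [Real.mul_rpow hτ.le (by positivity), ← Real.rpow_mul hqJ.le, mul_comm p.β]
            ring
        _ ≤ Cγ i * t₀ ^ γ i * (L.q ^ L.J) ^ (γ i * p.β) := by
            have := (hC i).le
            have := (hγ i).le
            gcongr
        _ ≤ _ := by
            gcongr
            exact ht1 i
    have h2 : 0 ≤ θ i := mul_nonneg (hC i).le (by positivity)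
    calc 4 * θ i ^ 2 ≤ 4 * (1 / 2 * (L.q ^ L.J) ^ (γ i * p.β)) ^ 2 := by gcongr
      _ = ((L.q ^ L.J) ^ (γ i * p.β)) ^ 2 := by ring
      _ = _ := by
          rw [← Real.rpow_natCast, ← Real.rpow_mul hqJ.le]
          congr 1
          push_cast
          ring
  have hinfo' : ∑ i, (n i : ℝ≥0∞) * (ENNReal.ofReal (4 * θ i ^ 2) * L.bumpMass) ≤ 2⁻¹ := by
    calc ∑ i, (n i : ℝ≥0∞) * (ENNReal.ofReal (4 * θ i ^ 2) * L.bumpMass)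
        ≤ ∑ i, (n i : ℝ≥0∞) * (ENNReal.ofReal ((L.q ^ L.J) ^ (2 * γ i * p.β))
            * ENNReal.ofReal ((L.q ^ L.J) ^ d)) := by
          gcongr with i
          · exact hθle i
          · exact L.bumpMass_le
      _ = ENNReal.ofReal (∑ i, (n i : ℝ) * (L.q ^ L.J) ^ (2 * γ i * p.β + d)) := by
          rw [ENNReal.ofReal_sum_of_nonneg fun i _ => by positivity]
          refine Finset.sum_congr rfl fun i _ => ?_
          rw [ENNReal.ofReal_mul (by positivity), ENNReal.ofReal_natCast, Real.rpow_add hqJ,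
            Real.rpow_natCast, ENNReal.ofReal_mul (by positivity)]
      _ ≤ ENNReal.ofReal (1 / 2) := ENNReal.ofReal_le_ofReal hinfo
      _ = 2⁻¹ := by rw [one_div, ENNReal.ofReal_inv_of_pos two_pos, ENNReal.ofReal_ofNat]
  refine le_iInf fun f => ?_
  obtain ⟨σ, hσ⟩ := assouad (d := d) n (regionLaw L.region)
    (B := fun u : Fin d → Fin L.side => L.piece (.inr u))
    (fun u => Metric.isClosed_closedBall.measurableSet)
    (fun u v huv => L.pairwise_disjoint fun h => huv (Sum.inr_injective h)) L.regionLaw_bump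
    (η := η) (fun σ i => (measurable_workerReg _ _).comp (hgm σ))
    (fun σ i x => workerReg_mem_Icc (hγ i) (hC i) (ht1 i) (hgt σ x)) (θ := θ) (hθ0 ▸ hh0)
    (fun σ i u x hx => by
      simp only [hη, hg]
      rw [stepReg_of_mem _ L.pairwise_disjoint hx]
      cases hu : σ u
      · simp only [height, hu, Bool.false_eq_true, if_false]
        exact workerReg_half_sub hh0
      · simp only [height, hu, if_true]
        exact workerReg_half_add hh0)
    (fun σ i u x hx => by
      simp only [hη, hg]
      rw [stepReg_congr_of_notMem (fun j hj => L.height_update τ p.β σ u _ hj) hx])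
    hinfo' f
  refine le_trans ?_ (le_iSup₂_of_le _ (hclass σ) hσ)
  rw [hθ0]
  calc ENNReal.ofReal (τ / 16 * (L.q / (8 * d)) ^ d * (L.q ^ L.J) ^ (p.β * (1 + p.α)))
      ≤ ENNReal.ofReal (h * ((L.side : ℝ) ^ d * ((L.q / (8 * d)) ^ d * (L.q ^ L.J) ^ d / 2))
          * 8⁻¹) := by
        refine ENNReal.ofReal_le_ofReal ?_
        have e1 : (L.q ^ L.J) ^ (p.β * (1 + p.α))
            = (L.q ^ L.J) ^ p.β * (L.q ^ L.J) ^ (p.α * p.β) := by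
          rw [← Real.rpow_add hqJ]
          congr 1
          ring
        -- By `side * q^J = q^K`, the number of balls times `(q^J)^d` is `(q^K)^d`.
        have e2 : h * ((L.side : ℝ) ^ d * ((L.q / (8 * d)) ^ d * (L.q ^ L.J) ^ d / 2)) * 8⁻¹
            = τ / 16 * (L.q / (8 * d)) ^ d * ((L.q ^ L.J) ^ p.β * (L.q ^ L.K) ^ d) := by
          rw [← L.side_mul_q_pow, mul_pow, hh]
          ring
        rw [e1, e2]
        gcongr
    _ = ENNReal.ofReal h * ((Fintype.card (Fin d → Fin L.side) : ℝ≥0∞)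
          * ENNReal.ofReal ((L.q / (8 * d)) ^ d * (L.q ^ L.J) ^ d / 2)) * 8⁻¹ := by
        rw [ENNReal.ofReal_mul (by positivity), ENNReal.ofReal_mul hh0.le,
          ENNReal.ofReal_mul (p := (L.side : ℝ) ^ d) (by positivity),
          ENNReal.ofReal_inv_of_pos (by norm_num),
          ENNReal.ofReal_ofNat, ← Nat.cast_pow, ENNReal.ofReal_natCast]
        simp
    _ ≤ _ := by
        gcongr
        exact L.le_bumpMass

/-- The uniform density on the region lies between the prescribed bounds. -/
theorem density_bounds {a b μ₁ : ℝ} (ha : 0 < a) (haμ : a * (1 + 5 * L.q) < μ₁) (hμb : μ₁ < b)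
    (hR : L.R ^ d * (volume (Metric.ball (0 : Feat d) 1)).toReal = μ₁⁻¹) :
    ENNReal.ofReal a < (volume L.region)⁻¹ ∧ (volume L.region)⁻¹ < ENNReal.ofReal b := by
  have hq := L.q_pos
  have hRp := L.R_pos
  have hμ₁ : 0 < μ₁ := lt_trans (by positivity) haμ
  have hvol := ENNReal.ofReal_toReal (volume_unitBall_ne_top (d := d))
  have hlow := L.le_volume_region
  have hup := L.volume_region_le
  rw [← hvol, ← ENNReal.ofReal_mul (by positivity)] at hlow hup
  constructor
  · rw [ENNReal.lt_inv_iff_lt_inv, ← ENNReal.ofReal_inv_of_pos ha]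
    refine hup.trans_lt ((ENNReal.ofReal_lt_ofReal_iff (inv_pos.2 ha)).2 ?_)
    -- Since `5 q ≤ 1` and `d ≥ 1`, the condition `haμ` on `q` can be free of `d`.
    have h5 : (5 * L.q) ^ d ≤ 5 * L.q := by
      refine pow_le_of_le_one (by positivity) (by linarith [L.q_le]) ?_
      have := L.dim_pos
      omega
    have e : (L.R ^ d + (5 * L.R * L.q) ^ d) * (volume (Metric.ball (0 : Feat d) 1)).toReal
        = μ₁⁻¹ * (1 + (5 * L.q) ^ d) := by
      rw [← hR, mul_right_comm 5, mul_pow _ L.R]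
      ring
    rw [e, inv_mul_eq_div, div_lt_iff₀ hμ₁, inv_mul_eq_div, lt_div_iff₀ ha]
    nlinarith
  · rw [hR] at hlow
    calc (volume L.region)⁻¹ ≤ (ENNReal.ofReal μ₁⁻¹)⁻¹ := ENNReal.inv_le_inv.2 hlow
      _ = ENNReal.ofReal μ₁ := by rw [ENNReal.ofReal_inv_of_pos hμ₁, inv_inv]
      _ < ENNReal.ofReal b := (ENNReal.ofReal_lt_ofReal_iff (hμ₁.trans hμb)).2 hμb

end Layout

end

/-! ### Sample sizes -/

theorem one_le_effSize {d : ℕ} {β : ℝ} (hβ : 0 < β) {m : ℕ} {n : Fin (m + 1) → ℕ}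
    {γ : Fin (m + 1) → ℝ} (hγ : ∀ i, 0 < γ i) (h : 0 < sizeRatio d β n γ) :
    1 ≤ effSize d β n γ := by
  obtain ⟨i, hi⟩ : ∃ i, n i ≠ 0 := by
    by_contra! hn
    simp [sizeRatio, hn] at h
  have h1 : (1 : ℝ) ≤ n i := by exact_mod_cast Nat.one_le_iff_ne_zero.2 hi
  have h2 : (1 : ℝ) ≤ (n i : ℝ) ^ ((2 * β + d) / (2 * γ i * β + d)) := by
    refine Real.one_le_rpow h1 ?_
    have := hγ i
    positivity
  exact h2.trans (Finset.single_le_sum (f := fun i => (n i : ℝ) ^ ((2 * β + d) / (2 * γ i * β + d)))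
    (fun _ _ => by positivity) (Finset.mem_univ i))

/-- Information in the sample about a perturbation at scale `s`. -/
theorem sum_mul_rpow_le {d : ℕ} (hd : 1 ≤ d) {β : ℝ} (hβ : 0 < β) {m : ℕ} {n : Fin (m + 1) → ℕ}
    {γ : Fin (m + 1) → ℝ} (hγ : ∀ i, 0 < γ i) (hS : 0 < effSize d β n γ) {s ε : ℝ} (hs : 0 < s)
    (hε : 0 < ε) (hε1 : ε ≤ 1) (hsε : s ≤ ε * effSize d β n γ ^ (-(1 / (2 * β + d)))) :
    ∑ i, (n i : ℝ) * s ^ (2 * γ i * β + d) ≤ ε * sizeRatio d β n γ := by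
  have hd' : (1 : ℝ) ≤ d := by exact_mod_cast hd
  rw [sizeRatio, Finset.mul_sum]
  refine Finset.sum_le_sum fun i _ => ?_
  have hγi := hγ i
  -- An exponent of at least `1` gives `ε ^ (2 γ_i β + d) ≤ ε`, so a single `ε` serves all `γ_i`.
  have hexp : 1 ≤ 2 * γ i * β + d := le_add_of_nonneg_of_le (by positivity) hd'
  have h1 : s ^ (2 * γ i * β + d)
      ≤ ε / effSize d β n γ ^ ((2 * γ i * β + d) / (2 * β + d)) := by
    calc s ^ (2 * γ i * β + d)
        ≤ (ε * effSize d β n γ ^ (-(1 / (2 * β + d)))) ^ (2 * γ i * β + d) := by gcongr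
      _ = ε ^ (2 * γ i * β + d) * (effSize d β n γ ^ ((2 * γ i * β + d) / (2 * β + d)))⁻¹ := by
          rw [Real.mul_rpow hε.le (by positivity), ← Real.rpow_mul hS.le, ← Real.rpow_neg hS.le]
          congr 2
          ring
      _ ≤ ε * (effSize d β n γ ^ ((2 * γ i * β + d) / (2 * β + d)))⁻¹ := by
          gcongr
          simpa using Real.rpow_le_rpow_of_exponent_ge hε hε1 hexp
      _ = _ := (div_eq_mul_inv _ _).symm
  calc (n i : ℝ) * s ^ (2 * γ i * β + d)
      ≤ n i * (ε / effSize d β n γ ^ ((2 * γ i * β + d) / (2 * β + d))) := by gcongr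
    _ = _ := by ring

/-- Rounding the exponent costs at most one factor `q⁻¹`; this is the factor `b` allowed in the
upper bound on the cluster size. -/
theorem pow_floor_bounds {q ρ : ℝ} (hq : 0 < q) (hq1 : q ≤ 1) (hρ : 0 ≤ ρ) (J : ℕ) :
    q ^ ⌊J * ρ⌋₊ ≤ q⁻¹ * (q ^ J) ^ ρ ∧ (q ^ J) ^ ρ ≤ q ^ ⌊J * ρ⌋₊ := by
  have e : (q ^ J) ^ ρ = q ^ (J * ρ) := by
    rw [← Real.rpow_natCast, ← Real.rpow_mul hq.le]
  rw [e, ← Real.rpow_natCast q]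
  constructor
  · rw [← Real.rpow_neg_one, ← Real.rpow_add hq]
    refine Real.rpow_le_rpow_of_exponent_ge hq hq1 ?_
    linarith [Nat.lt_floor_add_one (J * ρ)]
  · exact Real.rpow_le_rpow_of_exponent_ge hq hq1 (Nat.floor_le (by positivity))

end Crowd

/-! ### Choice of the constants and conclusion -/

theorem mainTheorem9 (d : ℕ) (hd : 1 ≤ d) (α β : ℝ) (hα : 0 ≤ α) (hβ : 0 < β)
    (hαβ : α * β ≤ d) (Cβ muMinus muPlus t₀ : ℝ) (hCβ : 0 < Cβ) (hmuMinus : 0 < muMinus)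
    (hmuPlus : muMinus < muPlus) (ht₀ : 0 < t₀) (ht₀' : t₀ ≤ 1 / 2) :
    ∃ Cα₀ cmu₀ rmu₀ : ℝ, 0 < Cα₀ ∧ 0 < cmu₀ ∧ 0 < rmu₀ ∧
      ∀ Cα cmu rmu : ℝ, Cα₀ ≤ Cα → 0 < cmu → cmu ≤ cmu₀ → 0 < rmu → rmu ≤ rmu₀ →
      ∀ CL CU : ℝ, 0 < CL → CL < CU →
      ∃ c : ℝ, 0 < c ∧
        ∀ (m : ℕ) (n : Fin (m + 1) → ℕ) (γ Cγ : Fin (m + 1) → ℝ),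
          γ 0 = 1 → Cγ 0 = 1 → (∀ i, 0 < γ i) → (∀ i, 0 < Cγ i) →
          (∀ i, Cγ i * t₀ ^ γ i ≤ 1 / 2) →
          (∀ i, 1 ≤ γ i → Cγ i * t₀ ^ (γ i - 1) ≤ 1) →
          CL < Crowd.sizeRatio d β n γ → Crowd.sizeRatio d β n γ < CU →
          ENNReal.ofReal
              (c * Crowd.effSize d β n γ ^ (-(β * (1 + α) / (2 * β + d))))
            ≤ Crowd.minimaxRisk d n
                { α := α, β := β, Cα := Cα, Cβ := Cβ, muMinus := muMinus, muPlus := muPlus,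
                  cmu := cmu, rmu := rmu } γ Cγ := by
  have hd' : (1 : ℝ) ≤ d := by exact_mod_cast hd
  have hd0 : (0 : ℝ) < d := by linarith
  -- The uniform law on the largest ball alone is given density `μ₁` through `R`; `b` is then large
  -- enough for the other balls not to push the density down to `muMinus`.
  set μ₁ := (muMinus + muPlus) / 2 with hμ₁
  have hμ₁0 : 0 < μ₁ := by linarith
  obtain ⟨b₀, hb₀⟩ := exists_nat_gt (5 * muMinus / (μ₁ - muMinus))
  set b := max 16 b₀ with hb
  have hb16 : 16 ≤ b := le_max_left _ _
  have hb16' : (16 : ℝ) ≤ b := by exact_mod_cast hb16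
  have hbμ : 5 * muMinus / (μ₁ - muMinus) < b :=
    hb₀.trans_le (by exact_mod_cast le_max_right _ _)
  set q : ℝ := (b : ℝ)⁻¹ with hq
  have hq0 : 0 < q := inv_pos.2 (by linarith)
  have hq1 : q < 1 := inv_lt_one_of_one_lt₀ (by linarith)
  have haμ : muMinus * (1 + 5 * q) < μ₁ := by
    have h1 : 0 < μ₁ - muMinus := by linarith
    rw [div_lt_iff₀ h1] at hbμ
    have h2 := mul_lt_mul_of_pos_right hbμ hq0
    rw [mul_right_comm (b : ℝ), hq, mul_inv_cancel₀ (by linarith), one_mul] at h2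
    linarith
  set v := (volume (Metric.ball (0 : Crowd.Feat d) 1)).toReal with hv
  have hv0 : 0 < v := ENNReal.toReal_pos Crowd.Layout.volume_unitBall_pos
    Crowd.Layout.volume_unitBall_ne_top
  set R := (μ₁⁻¹ / v) ^ (d : ℝ)⁻¹ with hR
  have hR0 : 0 < R := by positivity
  have hRv : R ^ d * v = μ₁⁻¹ := by
    rw [hR, Real.rpow_inv_natCast_pow (by positivity) (by omega), div_mul_cancel₀ _ hv0.ne']
  set κ := R * q / (2 * d) with hκ
  have hκ0 : 0 < κ := by positivity
  set τ := min t₀ (Cβ * (κ / 2) ^ β / 2) with hτ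
  have hτ0 : 0 < τ := lt_min ht₀ (by positivity)
  have hτC : 2 * τ ≤ Cβ * (κ / 2) ^ β := by linarith [min_le_right t₀ (Cβ * (κ / 2) ^ β / 2)]
  -- The thresholds involve only `b`, `R` and `τ`, fixed before `CL` and `CU`; of the parameters
  -- chosen next, `ε` alone depends on `CU`.
  refine ⟨(5 * b) ^ d * τ⁻¹ ^ α, (q / (80 * d)) ^ d, R, by positivity, by positivity, hR0, ?_⟩
  intro Cα cmu rmu hCα _ hcmu _ hrmu CL CU hCL hCU
  have hCU0 : 0 < CU := hCL.trans hCU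
  set ε := min 1 (1 / (2 * CU)) with hε
  have hε0 : 0 < ε := lt_min one_pos (by positivity)
  have hε1 : ε ≤ 1 := min_le_left _ _
  have hεCU : ε * CU ≤ 1 / 2 := by
    calc ε * CU ≤ 1 / (2 * CU) * CU := by
          gcongr
          exact min_le_right _ _
      _ = 1 / 2 := by field_simp
  refine ⟨τ / 16 * (q / (8 * d)) ^ d * (q * ε) ^ (β * (1 + α)), by positivity, ?_⟩
  intro m n γ Cγ hγ0 hC0 hγ hC ht1 ht2 hlow hupp
  -- The lower bound on the ratio excludes an empty sample; then `S ≥ 1`, so the target scale `y` is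
  -- at most `1`.
  have hS1 := Crowd.one_le_effSize hβ hγ (hCL.trans hlow)
  set S := Crowd.effSize d β n γ with hS
  have hS0 : 0 < S := by linarith
  set y := ε * S ^ (-(1 / (2 * β + d))) with hy
  have hy0 : 0 < y := by positivity
  have hy1 : y ≤ 1 := by
    refine mul_le_one₀ hε1 (by positivity) (Real.rpow_le_one_of_one_le_of_nonpos hS1 ?_)
    rw [neg_nonpos]
    positivity
  -- With `J = N + 1` the scale `q^J` is below `y`, as the information bound needs, and at least `q
  -- y`, which produces the factor `q * ε` in `c`.
  obtain ⟨N, hN1, hN2⟩ := exists_nat_pow_near_of_lt_one hy0 hy1 hq0 hq1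
  have hρ0 : 0 ≤ α * β / d := by positivity
  have hρ1 : α * β / d ≤ 1 := (div_le_one hd0).2 hαβ
  set K := ⌊((N + 1 : ℕ) : ℝ) * (α * β / d)⌋₊ with hK
  have hKJ : K ≤ N + 1 :=
    Nat.floor_le_of_le (mul_le_of_le_one_right (by positivity) hρ1)
  have hfloor := Crowd.pow_floor_bounds hq0 hq1.le hρ0 (N + 1)
  let L : Crowd.Layout d :=
    { b := b, R := R, J := N + 1, K := K, e := EuclideanSpace.single ⟨0, hd⟩ 1, dim_pos := hd,
      le_b := hb16, R_pos := hR0, K_le := hKJ, norm_e := by simp }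
  have hdens := L.density_bounds hmuMinus haμ (show μ₁ < muPlus by linarith) hRv
  refine le_trans (ENNReal.ofReal_le_ofReal ?_) (L.minimaxRisk_ge n (p :=
    { α := α, β := β, Cα := Cα, Cβ := Cβ, muMinus := muMinus, muPlus := muPlus,
      cmu := cmu, rmu := rmu }) hτ0 (min_le_left _ _) hα hβ hαβ hCβ hτC hCα hcmu hrmu hdens.1
      hdens.2 hγ0 hC0 hγ hC ht1 ht2 ?_ ?_ ?_)
  · change τ / 16 * (q / (8 * d)) ^ d * (q * ε) ^ (β * (1 + α)) * S ^ (-(β * (1 + α) / (2 * β + d)))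
      ≤ τ / 16 * (q / (8 * d)) ^ d * (q ^ (N + 1)) ^ (β * (1 + α))
    have hexp : 0 ≤ β * (1 + α) := by positivity
    calc τ / 16 * (q / (8 * d)) ^ d * (q * ε) ^ (β * (1 + α))
          * S ^ (-(β * (1 + α) / (2 * β + d)))
        = τ / 16 * (q / (8 * d)) ^ d * (q * y) ^ (β * (1 + α)) := by
          rw [hy, ← mul_assoc q, Real.mul_rpow (by positivity : 0 ≤ q * ε) (by positivity),
            ← Real.rpow_mul hS0.le, mul_assoc _ ((q * ε) ^ (β * (1 + α)))]
          congr 4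
          ring
      _ ≤ _ := by
          rw [pow_succ']
          gcongr
  · change q ^ K ≤ b * (q ^ (N + 1)) ^ (α * β / d)
    rw [hq, inv_inv] at hfloor
    exact hfloor.1
  · change (q ^ (N + 1)) ^ (α * β) ≤ (q ^ K) ^ d
    calc (q ^ (N + 1)) ^ (α * β) = ((q ^ (N + 1)) ^ (α * β / d)) ^ d := by
          rw [← Real.rpow_mul_natCast (by positivity), div_mul_cancel₀ _ hd0.ne']
      _ ≤ _ := by
          gcongr
          exact hfloor.2
  · change ∑ i, (n i : ℝ) * (q ^ (N + 1)) ^ (2 * γ i * β + d) ≤ 1 / 2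
    refine (Crowd.sum_mul_rpow_le hd hβ hγ hS0 (by positivity) hε0 hε1 hN1.le).trans ?_
    exact le_trans (by gcongr) hεCU
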